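/- All graphs are finite, undirected and simple, and have at least one vertex. For integers $k>\ell\ge 0$, let $c_{\ell,k}$ denote the least real number $c$ (if it exists) such that, for every $n\ge 1$, every $n$-vertex graph with at least $c\cdot n$ edges contains a cycle whose length is congruent to $\ell$ modulo $k$. Then $c_{2,4}$ exists and $$c_{2,4}=\frac52 .$$ -/

import Mathlib

/-- The graph `G` contains a cycle whose length is congruent to `ℓ` modulo `k`. -/
def SimpleGraph.HasCycleMod {V : Type*} (G : SimpleGraph V) (ℓ k : ℕ) : Prop :=
  ∃ (v : V) (p : G.Walk v v), p.IsCycle ∧ p.length ≡ ℓ [MOD k]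

/-- Every `n`-vertex (finite, simple, nonempty) graph with at least `c * n` edges contains a cycle
of length `ℓ` modulo `k`. -/
def ForcesCycleMod (ℓ k : ℕ) (c : ℝ) : Prop :=
  ∀ (n : ℕ), 0 < n → ∀ G : SimpleGraph (Fin n),
    c * (n : ℝ) ≤ (G.edgeSet.ncard : ℝ) → G.HasCycleMod ℓ k

/-- `c` is the Burr–Erdős constant `c_{ℓ,k}`: the least real number such that every `n`-vertex
graph with at least `c * n` edges contains a cycle of length `ℓ` modulo `k`. -/
def IsBurrErdosConstant (ℓ k : ℕ) (c : ℝ) : Prop :=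
  IsLeast {c' : ℝ | ForcesCycleMod ℓ k c'} c

/-! Upper bound. In a least counterexample every nonempty proper set `S` of vertices meets more than
`5|S|/2` edges, since otherwise deleting `S` would leave a smaller counterexample (`IsCritical`,
`hasCycleMod_of_five_mul_card_le`). Take a longest path `p 0, …, p t`. The neighbours of `p 0` are
on it, and likewise the start of any other path that joins `p` and has equally many vertices has all
its neighbours on that path (`IsLongestPath.neighbor_cases`). When all neighbours of `p 0, …, p
(k-1)` are on the path, the density condition for this set gives more than `3k/2` chords leading
upwards from it, besides the path edges: at least 2, 4, 5, 7 chords for `k = 1, 2, 3, 4`. If `p 1`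
has a neighbour `y` off the path, then `y` is a twin of `p 0`: it also has two chords, and it is
counted in `S` too. If `p 2` or `p 3` has a neighbour off the path, a branch of at most three
vertices hangs there whose last vertex has two chords.

Each of these configurations forces a cycle of length 2 mod 4. This is a finite problem, because the
lengths mod 4 of the relevant cycles depend only on the order and the coincidences of the chord ends
and on their positions mod 4. The search `noPlacement` inserts the chords one at a time and drops a
position as soon as a path of length 1 mod 4 already joins the two ends of the new chord. The
`refuted_…` theorems evaluate it; `IsPicture.hasCycleMod_of_noPlacement` is its soundness;
`not_isLongestPath_of_leaf` and `not_isLongestPath` combine the cases.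

Lower bound. In copies of `K₅` glued at one vertex every cycle stays in one copy, so its length is
3, 4 or 5, while `4m + 1` vertices carry `10m` edges, a density tending to `5/2`. -/

/-! ### The search for placements of chords -/

/-- A list of arcs `(target, weight mod 4, code)`.  The code is `12 * target` for an edge, and
`12 * target + 4`, `12 * target + 8` for a segment of the line walked upwards or downwards. -/
inductive Row where
  | nil : Row
  | cons (node wt code : ℕ) (tail : Row) : Row

/-- The arcs leaving the nodes `0, 1, 2, …`. -/
abbrev ArcTable := List Row

namespace ArcTable

/-- The functions used by the search are spelled with recursors and with the binary operations of
`Nat`, in a form that kernel evaluation handles well. -/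
def look (adj : ArcTable) : ℕ → Row :=
  List.rec (motive := fun _ => ℕ → Row) (fun _ => .nil)
    (fun a _ ih n => Nat.rec (motive := fun _ => Row) a (fun m _ => ih m) n) adj

def update (f : Row → Row) : ArcTable → ℕ → ArcTable
  | [], _ => []
  | a :: as, 0 => f a :: as
  | a :: as, n + 1 => a :: update f as n

/-- The set of all `code + (length mod 4)` for arrivals of simple paths that continue a path of
length `l` to `u` through the nodes in the bit set `vis`. -/
noncomputable def arrivals (adj : ArcTable) (fuel : ℕ) : ℕ → ℕ → ℕ → ℕ :=
  Nat.rec (motive := fun _ => ℕ → ℕ → ℕ → ℕ) (fun _ _ _ => 0)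
    (fun _ ih vis u l => Row.rec (motive := fun _ => ℕ) 0 (fun x w c _ r =>
      -- The case `0` of this recursion means that `x` has not been visited; otherwise the arc is
      -- skipped.
      Nat.rec (motive := fun _ => ℕ)
        (Nat.lor (Nat.lor (Nat.shiftLeft 1 (Nat.add c (Nat.mod (Nat.add l w) 4)))
          (ih (Nat.lor vis (Nat.shiftLeft 1 x)) x (Nat.mod (Nat.add l w) 4))) r)
        (fun _ _ => r) (Nat.land vis (Nat.shiftLeft 1 x))) (adj.look u)) fuel

/-- The first bit is the empty path. A bound on the fuel can only lose arrivals, which makes the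
search block fewer chords and so does not harm soundness. -/
noncomputable def allArrivals (adj : ArcTable) (v : ℕ) : ℕ :=
  Nat.lor (Nat.shiftLeft 1 (12 * v)) (arrivals adj 20 (Nat.shiftLeft 1 v) v 0)

def addEdge (adj : ArcTable) (u v : ℕ) : ArcTable :=
  update (.cons v 1 (12 * v)) (update (.cons u 1 (12 * u)) adj v) u

end ArcTable

/-- Replace the line-neighbour `a` by `b`, at distance `w`. -/
def Row.redirect (a b w k : ℕ) : Row → Row
  | .nil => .nil
  -- Comparing codes rather than targets spares a chord that joins the same two nodes.
  | .cons x w' c l => bif Nat.beq c (12 * a + k) then .cons b w (12 * b + k) (redirect a b w k l)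
      else .cons x w' c (redirect a b w k l)

/-- The residue of `b - a` mod `4`, for residues `a` and `b`. -/
def gapMod (a b : ℕ) : ℕ := (b + 4 - a) % 4

/-- Insert a new node of residue `r` after position `i` of the line. -/
def ArcTable.insertNode (adj : ArcTable) (line : List (ℕ × ℕ)) (i r : ℕ) : ArcTable :=
  match line.drop i with
  | [] => adj
  | [(p, rp)] => update (.cons adj.length (gapMod rp r) (12 * adj.length + 4)) adj p ++
      [.cons p (gapMod rp r) (12 * p + 8) .nil]
  | (p, rp) :: (q, rq) :: _ =>
    update (Row.redirect q adj.length (gapMod rp r) 4)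
      (update (Row.redirect p adj.length (gapMod r rq) 8) adj q) p
      ++ [.cons p (gapMod rp r) (12 * p + 8) (.cons q (gapMod r rq) (12 * q + 4) .nil)]

/-- The edge from the source of the arrivals `F` to the node `u` closes a cycle of length `2` mod
`4`. -/
def blocked (F u : ℕ) : Bool := !Nat.beq (Nat.land F (Nat.shiftLeft 546 (12 * u))) 0

/-- The same for an edge to a new node of residue `r` after position `i` of the line. -/
def blockedGap (F : ℕ) (line : List (ℕ × ℕ)) (i r : ℕ) : Bool :=
  match line.drop i with
  | [] => false
  -- `17 = 2^0 + 2^4` admits arrivals at `p` by an edge or from below, so the segment above `p` is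
  -- still free. The shift selects the length `m` with `m + (r - rp) ≡ 1` mod 4.
  | (p, rp) :: rest => !Nat.beq (Nat.land F (Nat.shiftLeft 17 (12 * p + (rp + 5 - r) % 4))) 0 ||
    match rest with
    | [] => false
    -- Symmetrically, `257 = 2^0 + 2^8` admits arrivals at `q` by an edge or from above, and `m +
    -- (rq - r) ≡ 1` mod 4.
    | (q, rq) :: _ => !Nat.beq (Nat.land F (Nat.shiftLeft 257 (12 * q + (r + 5 - rq) % 4))) 0

/-- The requirement that `node` has at least (or exactly) `atLeast` chords to the part of the line
after position `start`, and that `total` chords have been placed then. -/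
structure ChordTask where
  node : ℕ
  start : ℕ
  atLeast : ℕ
  exact : Bool
  total : ℕ

def firstStart (Ts : List ChordTask) : ℕ :=
  match Ts with
  | [] => 0
  | T :: _ => T.start

/-- Exhaustive search for a placement of chords without cycles of length `2` mod `4`; the value
`true` means that there is none. -/
noncomputable def noPlacement (fuel : ℕ) (Ts : List ChordTask) (cnt tot li : ℕ) (adj : ArcTable)
    (line : List (ℕ × ℕ)) : Bool :=
  match fuel with
  | 0 => false
  | f + 1 =>
    match Ts with
    | [] => false
    | T :: Ts' =>
      -- As soon as the current task may be closed, the remaining tasks must be refuted as well.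
      -- Running out of tasks gives `false`, for then a placement has survived.
      (!(Nat.ble T.atLeast cnt && Nat.ble T.total tot) ||
        noPlacement f Ts' 0 tot (firstStart Ts') adj line) &&
      ((T.exact && Nat.ble T.atLeast cnt) ||
        (List.range line.length).all fun i =>
          -- The chords of one task are placed by increasing height, so only nodes beyond the index
          -- `li` of the last end are tried.
          (Nat.ble i li || (blocked (adj.allArrivals T.node) (line.getD i (0, 0)).1 ||
            noPlacement f Ts (cnt + 1) (tot + 1) i
              (adj.addEdge T.node (line.getD i (0, 0)).1) line)) &&
          -- The nodes `0, …, 3` are consecutive vertices of the path, so new nodes appear only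
          -- after index 3.
          (!(Nat.ble li i && Nat.ble 3 i) || [0, 1, 2, 3].all fun r =>
            blockedGap (adj.allArrivals T.node) line i r ||
            noPlacement f Ts (cnt + 1) (tot + 1) (i + 1)
              ((adj.insertNode line i r).addEdge T.node adj.length)
              (line.take (i + 1) ++ (adj.length, r) :: line.drop (i + 1))))

def baseLine : List (ℕ × ℕ) := [(0, 0), (1, 1), (2, 2), (3, 3)]

def baseTable (k : ℕ) (es : List (ℕ × ℕ)) : ArcTable :=
  es.foldr (fun e a => a.addEdge e.1 e.2) (List.replicate (4 + k) Row.nil)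

/-- The search succeeds, starting from the path through the nodes `0, …, 3` with `k` further nodes
joined by the edges `es`. -/
noncomputable def refuted (k : ℕ) (es : List (ℕ × ℕ)) (Ts : List ChordTask) : Bool :=
  noPlacement 100 Ts 0 0 (firstStart Ts) (baseTable k ((0, 1) :: (1, 2) :: (2, 3) :: es)) baseLine

/-! ### The computations -/

/-- The totals 4, 5, 7 are the least integers above `3k/2` for `k = 2, 3, 4`. In the searches below
with a branch the two chords of the branch come first and raise each total by 2; with a twin of node
0 the bounds for three and four vertices are 5 and 7. -/
theorem refuted_chain :
    refuted 0 [] [⟨0, 1, 2, false, 0⟩, ⟨1, 2, 0, false, 4⟩, ⟨2, 3, 0, false, 5⟩, ⟨3, 3, 0, false, 7⟩] := by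
  decide +kernel

theorem refuted_chain_branch_one :
    refuted 1 [(3, 4)] [⟨4, 3, 2, true, 0⟩, ⟨0, 1, 2, false, 0⟩, ⟨1, 2, 0, false, 6⟩,
      ⟨2, 3, 0, false, 7⟩] := by
  decide +kernel

theorem refuted_chain_branch_two :
    refuted 2 [(3, 4), (4, 5)] [⟨5, 2, 2, true, 0⟩, ⟨0, 1, 2, false, 0⟩, ⟨1, 2, 0, false, 6⟩,
      ⟨2, 3, 0, false, 7⟩] := by
  decide +kernel

theorem refuted_chain_branch_three :
    refuted 3 [(3, 4), (4, 5), (5, 6)] [⟨6, 2, 2, true, 0⟩, ⟨0, 1, 2, false, 0⟩,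
      ⟨1, 2, 0, false, 6⟩, ⟨2, 3, 0, false, 7⟩] := by
  decide +kernel

theorem refuted_short_chain_branch_one :
    refuted 1 [(2, 4)] [⟨4, 2, 2, true, 0⟩, ⟨0, 1, 2, false, 0⟩, ⟨1, 2, 0, false, 6⟩] := by
  decide +kernel

theorem refuted_short_chain_branch_two :
    refuted 2 [(2, 4), (4, 5)] [⟨5, 1, 2, true, 0⟩, ⟨0, 1, 2, false, 0⟩, ⟨1, 2, 0, false, 6⟩] := by
  decide +kernel

theorem refuted_twin_branch_one :
    refuted 2 [(2, 4), (1, 5)] [⟨4, 2, 2, true, 0⟩, ⟨0, 1, 2, false, 0⟩, ⟨5, 1, 2, false, 0⟩,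
      ⟨1, 2, 0, false, 7⟩] := by
  decide +kernel

theorem refuted_twin_branch_two :
    refuted 3 [(2, 4), (4, 5), (1, 6)] [⟨5, 1, 2, true, 0⟩, ⟨0, 1, 2, false, 0⟩,
      ⟨6, 1, 2, false, 0⟩, ⟨1, 2, 0, false, 7⟩] := by
  decide +kernel

theorem refuted_three_leaves :
    refuted 2 [(1, 4), (1, 5)] [⟨0, 1, 2, true, 0⟩, ⟨4, 1, 2, true, 0⟩, ⟨5, 1, 2, true, 0⟩] := by
  decide +kernel

theorem refuted_twin :
    refuted 1 [(1, 4)] [⟨0, 1, 2, false, 0⟩, ⟨4, 1, 2, false, 0⟩, ⟨1, 2, 0, false, 5⟩,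
      ⟨2, 3, 0, false, 7⟩] := by
  decide +kernel

/-! ### Elementary facts on rows and tables -/

namespace Row

def All (P : ℕ → ℕ → ℕ → Prop) : Row → Prop
  | .nil => True
  | .cons x w c l => P x w c ∧ All P l

theorem All.imp {P Q : ℕ → ℕ → ℕ → Prop} (h : ∀ x w c, P x w c → Q x w c) :
    ∀ {l : Row}, l.All P → l.All Q
  | .nil, _ => trivial
  | .cons _ _ _ _, hl => ⟨h _ _ _ hl.1, hl.2.imp h⟩

theorem All.redirect {P Q : ℕ → ℕ → ℕ → Prop} {a b w k : ℕ} (hb : Q b w (12 * b + k))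
    (h : ∀ x w' c, c ≠ 12 * a + k → P x w' c → Q x w' c) :
    ∀ {l : Row}, l.All P → (l.redirect a b w k).All Q
  | .nil, _ => trivial
  | .cons x w' c l, hl => by
    rw [Row.redirect]
    cases hc : Nat.beq c (12 * a + k)
    · exact ⟨h _ _ _ (Nat.ne_of_beq_eq_false hc) hl.1, hl.2.redirect hb h⟩
    · exact ⟨hb, hl.2.redirect hb h⟩

end Row

namespace ArcTable

@[simp] theorem length_update (f : Row → Row) : ∀ (adj : ArcTable) (n : ℕ),
    (update f adj n).length = adj.length
  | [], _ => rfl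
  | _ :: _, 0 => rfl
  | _ :: as, n + 1 => by simp [update, length_update f as n]

theorem look_update_self (f : Row → Row) : ∀ {adj : ArcTable} {n : ℕ}, n < adj.length →
    look (update f adj n) n = f (look adj n)
  | [], _, h => absurd h (by simp)
  | _ :: _, 0, _ => rfl
  | _ :: as, n + 1, h => look_update_self f (adj := as) (by simpa using h)

theorem look_update_of_ne (f : Row → Row) : ∀ (adj : ArcTable) {n m : ℕ}, m ≠ n →
    look (update f adj n) m = look adj m
  | [], _, _, _ => rfl
  | _ :: _, 0, 0, h => absurd rfl h
  | _ :: _, 0, _ + 1, _ => rfl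
  | _ :: _, _ + 1, 0, _ => rfl
  | _ :: as, n + 1, m + 1, h => look_update_of_ne f as (by simpa using h)

theorem look_append_left : ∀ (adj as : ArcTable) {n : ℕ}, n < adj.length →
    look (adj ++ as) n = look adj n
  | [], _, _, h => absurd h (by simp)
  | _ :: _, _, 0, _ => rfl
  | _ :: adj, as, _ + 1, h => look_append_left adj as (by simpa using h)

theorem look_append_length : ∀ (adj : ArcTable) (a : Row), look (adj ++ [a]) adj.length = a
  | [], _ => rfl
  | _ :: adj, a => look_append_length adj a

@[simp] theorem length_addEdge (adj : ArcTable) (u v : ℕ) :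
    (adj.addEdge u v).length = adj.length := by
  simp [addEdge]

end ArcTable

/-! ### Interpretation of a search state in a graph -/

/-- An interpretation of the nodes of a search state: the vertex, and for nodes of the line the
position on the line. -/
structure Layout (V : Type*) where
  node : ℕ → V
  height : ℕ → ℕ

namespace Layout

variable {V : Type*} (D : Layout V)

/-- The nodes `u` and `x` follow each other on the line. -/
def Consecutive (line : List (ℕ × ℕ)) (u x : ℕ) : Prop :=
  (u ∈ line.map Prod.fst ∧ x ∈ line.map Prod.fst) ∧ D.height u < D.height x ∧
    ∀ a ∈ line.map Prod.fst, D.height a ≤ D.height u ∨ D.height x ≤ D.height a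

/-- The code of an arc also tells whether a segment next to `x` was used to enter it; this decides
on which side of `x` the line is still free. -/
def IsArc (H : SimpleGraph V) (line : List (ℕ × ℕ)) (u x w c : ℕ) : Prop :=
  (c = 12 * x ∧ w = 1 ∧ H.Adj (D.node u) (D.node x)) ∨
  (c = 12 * x + 4 ∧ D.Consecutive line u x ∧ (D.height u + w) % 4 = D.height x % 4) ∨
  (c = 12 * x + 8 ∧ D.Consecutive line x u ∧ (D.height x + w) % 4 = D.height u % 4)

/-- The search state `(adj, line)` describes a part of the graph `H`, in which `p 0, …, p t` is a
path. -/
structure IsPicture (H : SimpleGraph V) (p : ℕ → V) (t : ℕ) (adj : ArcTable)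
    (line : List (ℕ × ℕ)) : Prop where
  sorted : line.Pairwise fun a b => D.height a.1 < D.height b.1
  lt_length : ∀ a ∈ line, a.1 < adj.length
  residue : ∀ a ∈ line, a.2 = D.height a.1 % 4
  node_eq : ∀ a ∈ line.map Prod.fst, D.node a = p (D.height a)
  height_le : ∀ a ∈ line.map Prod.fst, D.height a ≤ t
  inj : ∀ u < adj.length, ∀ v < adj.length, D.node u = D.node v → u = v
  off : ∀ u < adj.length, u ∉ line.map Prod.fst → ∀ k ≤ t, D.node u ≠ p k
  arcs : ∀ u < adj.length, (adj.look u).All fun x w c => x < adj.length ∧ D.IsArc H line u x w c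
  path : ∀ i < t, H.Adj (p i) (p (i + 1))
  path_inj : ∀ i ≤ t, ∀ j ≤ t, p i = p j → i = j

end Layout

/-! ### Extending paths along the line and closing cycles -/

namespace SimpleGraph

variable {V : Type*} {H : SimpleGraph V} {p : ℕ → V} {t : ℕ}

theorem Walk.IsPath.exists_extend_up {s : V} (hp : ∀ i < t, H.Adj (p i) (p (i + 1)))
    (hinj : ∀ i ≤ t, ∀ j ≤ t, p i = p j → i = j) {a : ℕ} (q : H.Walk s (p a)) (hq : q.IsPath)
    (n : ℕ) (hn : a + n ≤ t) (hfree : ∀ k, a < k → k ≤ a + n → p k ∉ q.support) :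
    ∃ q' : H.Walk s (p (a + n)), q'.IsPath ∧ q'.length = q.length + n ∧
      ∀ v ∈ q'.support, v ∈ q.support ∨ ∃ k, a < k ∧ k ≤ a + n ∧ v = p k := by
  induction n with
  | zero => exact ⟨q, hq, rfl, fun v hv => .inl hv⟩
  | succ n ih =>
    obtain ⟨q', hq', hl, hs⟩ := ih (by omega) fun k h1 h2 => hfree k h1 (by omega)
    refine ⟨q'.concat (hp (a + n) (by omega)), hq'.concat (fun hmem => ?_) _, ?_, fun v hv => ?_⟩
    · rcases hs _ hmem with h | ⟨k, h1, h2, h3⟩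
      · exact hfree _ (by omega) (by omega) h
      · have := hinj _ (by omega) _ (by omega) h3
        omega
    · rw [Walk.length_concat, hl]; omega
    · rw [Walk.support_concat, List.mem_append, List.mem_singleton] at hv
      rcases hv with h | h
      · rcases hs _ h with h | ⟨k, h1, h2, h3⟩
        · exact .inl h
        · exact .inr ⟨k, h1, by omega, h3⟩
      · exact .inr ⟨a + (n + 1), by omega, le_rfl, h⟩

theorem Walk.IsPath.exists_extend_down {s : V} (hp : ∀ i < t, H.Adj (p i) (p (i + 1)))
    (hinj : ∀ i ≤ t, ∀ j ≤ t, p i = p j → i = j) (n : ℕ) {a : ℕ} (q : H.Walk s (p (a + n)))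
    (hq : q.IsPath) (hn : a + n ≤ t) (hfree : ∀ k, a ≤ k → k < a + n → p k ∉ q.support) :
    ∃ q' : H.Walk s (p a), q'.IsPath ∧ q'.length = q.length + n ∧
      ∀ v ∈ q'.support, v ∈ q.support ∨ ∃ k, a ≤ k ∧ k < a + n ∧ v = p k := by
  induction n generalizing a with
  | zero => exact ⟨q, hq, rfl, fun v hv => .inl hv⟩
  | succ n ih =>
    have e : a + (n + 1) = (a + 1) + n := by omega
    obtain ⟨q', hq', hl, hs⟩ := ih (a := a + 1) (q.copy rfl (by rw [e])) (by simpa using hq)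
      (by omega) fun k h1 h2 => by simpa using hfree k (by omega) (by omega)
    simp only [Walk.support_copy, Walk.length_copy] at hs hl
    refine ⟨q'.concat (hp a (by omega)).symm, hq'.concat (fun hmem => ?_) _, ?_, fun v hv => ?_⟩
    · rcases hs _ hmem with h | ⟨k, h1, h2, h3⟩
      · exact hfree _ le_rfl (by omega) h
      · have := hinj _ (by omega) _ (by omega) h3
        omega
    · rw [Walk.length_concat, hl]; omega
    · rw [Walk.support_concat, List.mem_append, List.mem_singleton] at hv
      rcases hv with h | h
      · rcases hs _ h with h | ⟨k, h1, h2, h3⟩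
        · exact .inl h
        · exact .inr ⟨k, by omega, by omega, h3⟩
      · exact .inr ⟨a, le_rfl, by omega, h⟩

/-- The closing edge is missing from `H`, so the path cannot use it, and a genuine cycle arises. -/
theorem hasCycleMod_of_isPath {G H : SimpleGraph V} (hHG : H ≤ G) {u v : V} (q : H.Walk u v)
    (hq : q.IsPath) (hl : q.length % 4 = 1) (hG : G.Adj u v) (hH : ¬ H.Adj u v) :
    G.HasCycleMod 2 4 := by
  refine ⟨v, .cons hG.symm (q.mapLe hHG), ?_, ?_⟩
  · rw [Walk.cons_isCycle_iff]
    refine ⟨hq.mapLe hHG, fun h => hH ?_⟩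
    rw [Walk.edges_mapLe_eq_edges] at h
    exact (Walk.adj_of_mem_edges q h).symm
  · simp only [Walk.length_cons, Walk.length_map, Nat.ModEq, Walk.mapLe]
    omega

end SimpleGraph

/-! ### Recorded arrivals come from paths -/

namespace Layout

variable {V : Type*} {D : Layout V} {H : SimpleGraph V} {p : ℕ → V} {t : ℕ} {adj : ArcTable}
  {line : List (ℕ × ℕ)}

theorem IsPicture.lt_of_mem (hP : D.IsPicture H p t adj line) {x : ℕ}
    (hx : x ∈ line.map Prod.fst) : x < adj.length := by
  obtain ⟨a, ha, rfl⟩ := List.mem_map.1 hx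
  exact hP.lt_length a ha

theorem IsPicture.eq_of_height_eq (hP : D.IsPicture H p t adj line) {x y : ℕ}
    (hx : x ∈ line.map Prod.fst) (hy : y ∈ line.map Prod.fst) (h : D.height x = D.height y) :
    x = y :=
  hP.inj _ (hP.lt_of_mem hx) _ (hP.lt_of_mem hy) (by rw [hP.node_eq _ hx, hP.node_eq _ hy, h])

theorem IsPicture.mem_of_node_eq (hP : D.IsPicture H p t adj line) {x k : ℕ}
    (hx : x < adj.length) (hk : k ≤ t) (h : D.node x = p k) :
    x ∈ line.map Prod.fst ∧ D.height x = k := by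
  by_cases hl : x ∈ line.map Prod.fst
  · exact ⟨hl, hP.path_inj _ (hP.height_le _ hl) _ hk (by rw [← hP.node_eq _ hl, h])⟩
  · exact absurd h (hP.off x hx hl k hk)

/-- The vertices that a path through the set `W` of nodes may visit. -/
def covered (D : Layout V) (p : ℕ → V) (line : List (ℕ × ℕ)) (W : Set ℕ) : Set V :=
  {v | (∃ x ∈ W, v = D.node x) ∨ ∃ a ∈ W, ∃ b ∈ W, D.Consecutive line a b ∧
    ∃ k, D.height a < k ∧ k < D.height b ∧ v = p k}

theorem covered_mono {W W' : Set ℕ} (h : W ⊆ W') : D.covered p line W ⊆ D.covered p line W' := by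
  rintro v (⟨x, hx, rfl⟩ | ⟨a, ha, b, hb, hk⟩)
  · exact .inl ⟨x, h hx, rfl⟩
  · exact .inr ⟨a, h ha, b, h hb, hk⟩

/-- The path `q` ends at the node `x` and does not visit the line immediately above it (unless
`κ = 2`) or immediately below it (unless `κ = 1`). -/
def IsClear (D : Layout V) (p : ℕ → V) (t : ℕ) (line : List (ℕ × ℕ)) (S : List V) (x κ : ℕ) :
    Prop :=
  (κ ≠ 2 → x ∈ line.map Prod.fst → ∀ k, D.height x < k → k ≤ t →
    (∀ a ∈ line.map Prod.fst, D.height a ≤ D.height x ∨ k < D.height a) → p k ∉ S) ∧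
  (κ ≠ 1 → x ∈ line.map Prod.fst → ∀ k < D.height x,
    (∀ a ∈ line.map Prod.fst, D.height x ≤ D.height a ∨ D.height a < k) → p k ∉ S)

theorem IsPicture.height_cases (hP : D.IsPicture H p t adj line) {W : Set ℕ}
    (hW : ∀ y ∈ W, y < adj.length) {k : ℕ} (hk : k ≤ t) (h : p k ∈ D.covered p line W) :
    (∃ y ∈ W, y ∈ line.map Prod.fst ∧ D.height y = k) ∨
    ∃ a ∈ W, ∃ b ∈ W, D.Consecutive line a b ∧ D.height a < k ∧ k < D.height b := by
  rcases h with ⟨y, hy, h⟩ | ⟨a, ha, b, hb, hc, j, h1, h2, h3⟩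
  · exact .inl ⟨y, hy, hP.mem_of_node_eq (hW y hy) hk h.symm⟩
  · have := hP.path_inj k hk j (by have := hP.height_le b hc.1.2; omega) h3
    subst this
    exact .inr ⟨a, ha, b, hb, hc, h1, h2⟩

/-- A covered vertex inside a segment has both ends of this segment in `W`, whereas the segments
next to `x` have the end `x ∉ W`. -/
theorem IsPicture.isClear_covered (hP : D.IsPicture H p t adj line) {W : Set ℕ}
    (hW : ∀ y ∈ W, y < adj.length) {x : ℕ} (hx : x ∉ W) {S : List V}
    (hS : ∀ v ∈ S, v ∈ D.covered p line W) (κ : ℕ) : D.IsClear p t line S x κ := by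
  refine ⟨fun _ hxl k h1 h2 h3 hk => ?_, fun _ hxl k h1 h3 hk => ?_⟩
  · rcases hP.height_cases hW h2 (hS _ hk) with ⟨y, hy, hyl, rfl⟩ | ⟨a, ha, b, hb, hc, h4, h5⟩
    · have := h3 y hyl; omega
    · have := hP.eq_of_height_eq hc.1.1 hxl
      have hne : D.height a ≠ D.height x := fun h => hx (this h ▸ ha)
      have := h3 a hc.1.1
      have := hc.2.2 x hxl
      omega
  · rcases hP.height_cases hW (by have := hP.height_le x hxl; omega) (hS _ hk) with
      ⟨y, hy, hyl, rfl⟩ | ⟨a, ha, b, hb, hc, h4, h5⟩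
    · have := h3 y hyl; omega
    · have := hP.eq_of_height_eq hc.1.2 hxl
      have hne : D.height b ≠ D.height x := fun h => hx (this h ▸ hb)
      have := h3 b hc.1.2
      have := hc.2.2 x hxl
      omega

/-- Segments are walked from end to end or not at all, so one unvisited end keeps the interior of
the segment free. -/
theorem IsPicture.not_mem_covered_of_consecutive (hP : D.IsPicture H p t adj line) {W : Set ℕ}
    (hW : ∀ y ∈ W, y < adj.length) {u x z : ℕ} (hc : D.Consecutive line u x) (hz : z = u ∨ z = x)
    (hzW : z ∉ W) {k : ℕ} (h1 : D.height u < k ∨ z = u ∧ D.height u = k)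
    (h2 : k < D.height x ∨ z = x ∧ k = D.height x) : p k ∉ D.covered p line W := by
  intro hk
  have hxt := hP.height_le x hc.1.2
  have hux := hc.2.1
  rcases hP.height_cases hW (by omega) hk with ⟨y, hy, hyl, rfl⟩ | ⟨a, ha, b, hb, hc', h4, h5⟩
  · have := hc.2.2 y hyl
    have e1 := hP.eq_of_height_eq hyl hc.1.1
    have e2 := hP.eq_of_height_eq hyl hc.1.2
    have n1 : z = u → D.height y ≠ D.height u := fun h h' => hzW (h ▸ e1 h' ▸ hy)
    have n2 : z = x → D.height y ≠ D.height x := fun h h' => hzW (h ▸ e2 h' ▸ hy)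
    omega
  · have e1 := hP.eq_of_height_eq hc'.1.1 hc.1.1
    have e2 := hP.eq_of_height_eq hc'.1.2 hc.1.2
    have n1 : z = u → D.height a ≠ D.height u := fun h h' => hzW (h ▸ e1 h' ▸ ha)
    have n2 : z = x → D.height b ≠ D.height x := fun h h' => hzW (h ▸ e2 h' ▸ hb)
    have := hc.2.2 a hc'.1.1
    have := hc.2.2 b hc'.1.2
    have := hc'.2.2 u hc.1.1
    have := hc'.2.2 x hc.1.2
    omega

/-- Tracking visited nodes suffices to keep paths simple: a segment leading to the new node `x`
cannot have been walked before. On arrival at most the segment just walked is occupied next to `x`,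
and `κ` names it. -/
theorem IsPicture.exists_step (hP : D.IsPicture H p t adj line) {W : Set ℕ}
    (hW : ∀ y ∈ W, y < adj.length) {s u x w c : ℕ} (huW : u ∈ W) (hxW : x ∉ W)
    (hx : x < adj.length) (harc : D.IsArc H line u x w c) (q : H.Walk (D.node s) (D.node u))
    (hq : q.IsPath) (hS : ∀ v ∈ q.support, v ∈ D.covered p line W) :
    ∃ κ < 3, c = 12 * x + 4 * κ ∧ ∃ q' : H.Walk (D.node s) (D.node x), q'.IsPath ∧
      q'.length % 4 = (q.length + w) % 4 ∧
      (∀ v ∈ q'.support, v ∈ D.covered p line (insert x W)) ∧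
      D.IsClear p t line q'.support x κ := by
  have hclear := fun κ => hP.isClear_covered hW hxW hS κ
  have hsub : D.covered p line W ⊆ D.covered p line (insert x W) :=
    covered_mono (Set.subset_insert _ _)
  have hxc : D.node x ∈ D.covered p line (insert x W) := .inl ⟨x, Set.mem_insert _ _, rfl⟩
  rcases harc with ⟨rfl, rfl, hadj⟩ | ⟨rfl, hc, hw⟩ | ⟨rfl, hc, hw⟩
  · refine ⟨0, by omega, by omega, q.concat hadj, hq.concat (fun hmem => ?_) _, by simp, ?_, ?_⟩
    · rcases hS _ hmem with ⟨y, hy, h⟩ | ⟨a, ha, b, hb, hc, k, h1, h2, h3⟩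
      · exact hxW (hP.inj x hx y (hW y hy) h ▸ hy)
      · have := hP.height_le b hc.1.2
        obtain ⟨hxl, rfl⟩ := hP.mem_of_node_eq hx (by omega) h3
        have := hc.2.2 x hxl
        omega
    · intro v hv
      rw [SimpleGraph.Walk.support_concat, List.mem_append, List.mem_singleton] at hv
      rcases hv with h | rfl
      · exact hsub (hS _ h)
      · exact hxc
    · constructor
      · intro h0 hxl k h1 h2 h3 hk
        rw [SimpleGraph.Walk.support_concat, List.mem_append, List.mem_singleton] at hk
        rcases hk with h | h
        · exact (hclear 0).1 h0 hxl k h1 h2 h3 h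
        · have := (hP.mem_of_node_eq hx h2 h.symm).2; omega
      · intro h0 hxl k h1 h3 hk
        rw [SimpleGraph.Walk.support_concat, List.mem_append, List.mem_singleton] at hk
        rcases hk with h | h
        · exact (hclear 0).2 h0 hxl k h1 h3 h
        · have := hP.height_le x hxl
          have := (hP.mem_of_node_eq hx (by omega) h.symm).2; omega
  · have hxt := hP.height_le x hc.1.2
    have hux := hc.2.1
    obtain ⟨n, hn⟩ : ∃ n, D.height x = D.height u + n := ⟨_, (Nat.add_sub_cancel' hux.le).symm⟩
    have eu := hP.node_eq u hc.1.1
    have ex : D.node x = p (D.height u + n) := by rw [hP.node_eq x hc.1.2, hn]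
    obtain ⟨q', h1, h2, h3⟩ := SimpleGraph.Walk.IsPath.exists_extend_up hP.path hP.path_inj
      (q.copy rfl eu) (by simpa using hq) n (by omega) fun k hk1 hk2 hmem =>
        hP.not_mem_covered_of_consecutive hW hc (.inr rfl) hxW (.inl hk1) (k := k) (by omega)
          (hS _ (by simpa using hmem))
    simp only [SimpleGraph.Walk.support_copy, SimpleGraph.Walk.length_copy] at h2 h3
    refine ⟨1, by omega, by omega, q'.copy rfl ex.symm, by simpa using h1,
      by simp only [SimpleGraph.Walk.length_copy]; omega, ?_, ?_⟩
    · intro v hv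
      simp only [SimpleGraph.Walk.support_copy] at hv
      rcases h3 _ hv with h | ⟨k, hk1, hk2, rfl⟩
      · exact hsub (hS _ h)
      · rcases (show k < D.height x ∨ k = D.height u + n by omega) with h | rfl
        · exact .inr ⟨u, Set.mem_insert_of_mem _ huW, x, Set.mem_insert _ _, hc, k, hk1, h, rfl⟩
        · exact ex ▸ hxc
    · refine ⟨fun h0 hxl k hk1 hk2 hk3 hk => ?_, fun h => absurd rfl h⟩
      simp only [SimpleGraph.Walk.support_copy] at hk
      rcases h3 _ hk with h | ⟨j, hj1, hj2, hj⟩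
      · exact (hclear 1).1 h0 hxl k hk1 hk2 hk3 h
      · have := hP.path_inj k hk2 j (by omega) hj
        omega
  · have hut := hP.height_le u hc.1.2
    have hux := hc.2.1
    obtain ⟨n, hn⟩ : ∃ n, D.height u = D.height x + n := ⟨_, (Nat.add_sub_cancel' hux.le).symm⟩
    have ex := hP.node_eq x hc.1.1
    have eu : D.node u = p (D.height x + n) := by rw [hP.node_eq u hc.1.2, hn]
    obtain ⟨q', h1, h2, h3⟩ := SimpleGraph.Walk.IsPath.exists_extend_down hP.path hP.path_inj n
      (q.copy rfl eu) (by simpa using hq) (by omega) fun k hk1 hk2 hmem =>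
        hP.not_mem_covered_of_consecutive hW hc (.inl rfl) hxW (k := k) (by omega)
          (.inl (by omega)) (hS _ (by simpa using hmem))
    simp only [SimpleGraph.Walk.support_copy, SimpleGraph.Walk.length_copy] at h2 h3
    refine ⟨2, by omega, by omega, q'.copy rfl ex.symm, by simpa using h1,
      by simp only [SimpleGraph.Walk.length_copy]; omega, ?_, ?_⟩
    · intro v hv
      simp only [SimpleGraph.Walk.support_copy] at hv
      rcases h3 _ hv with h | ⟨k, hk1, hk2, rfl⟩
      · exact hsub (hS _ h)
      · rcases (show D.height x < k ∨ k = D.height x by omega) with h | rfl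
        · exact .inr ⟨x, Set.mem_insert _ _, u, Set.mem_insert_of_mem _ huW, hc, k, h,
            by omega, rfl⟩
        · exact ex ▸ hxc
    · refine ⟨fun h => absurd rfl h, fun h0 hxl k hk1 hk3 hk => ?_⟩
      simp only [SimpleGraph.Walk.support_copy] at hk
      rcases h3 _ hk with h | ⟨j, hj1, hj2, hj⟩
      · exact (hclear 2).2 h0 hxl k hk1 hk3 h
      · have := hP.path_inj k (by omega) j (by omega) hj
        omega

/-- There is a path from the node `s` to the node `x` that arrives in the way coded by `κ` and has
length `m` mod `4`. -/
def IsArrival (D : Layout V) (H : SimpleGraph V) (p : ℕ → V) (t : ℕ) (line : List (ℕ × ℕ))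
    (s x κ m : ℕ) : Prop :=
  ∃ q : H.Walk (D.node s) (D.node x), q.IsPath ∧ q.length % 4 = m ∧
    D.IsClear p t line q.support x κ

/-- Only this direction is needed: each recorded bit is witnessed by a path. Completeness of the
enumeration plays no role. -/
theorem IsPicture.of_testBit_arrivals (hP : D.IsPicture H p t adj line) {s : ℕ} (fuel : ℕ) :
    ∀ (vis u l : ℕ) (W : Set ℕ), (∀ x, vis.testBit x = true ↔ x ∈ W) →
    (∀ y ∈ W, y < adj.length) → u ∈ W → ∀ q : H.Walk (D.node s) (D.node u), q.IsPath →
    q.length % 4 = l % 4 → (∀ v ∈ q.support, v ∈ D.covered p line W) →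
    ∀ k, (adj.arrivals fuel vis u l).testBit k = true →
    ∃ x κ m, κ < 3 ∧ m < 4 ∧ k = 12 * x + 4 * κ + m ∧ D.IsArrival H p t line s x κ m := by
  induction fuel with
  | zero =>
    intro vis u l W _ _ _ q _ _ _ k hk
    simp [ArcTable.arrivals] at hk
  | succ f ih =>
    intro vis u l W hvis hW hu q hq hl hS k hk
    have harcs := hP.arcs u (hW u hu)
    unfold ArcTable.arrivals at hk
    simp only at hk
    generalize adj.look u = row at harcs hk
    induction row with
    | nil => simp at hk
    | cons x w c tail iht =>
      simp only at hk
      obtain ⟨⟨hx, harc⟩, htail⟩ := harcs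
      rcases hland : Nat.land vis (Nat.shiftLeft 1 x) with _ | b
      · rw [hland] at hk
        have hxW : x ∉ W := by
          intro hx
          have := (hvis x).2 hx
          have h2 : (vis &&& (1 <<< x)).testBit x = false := by
            rw [show vis &&& (1 <<< x) = 0 from hland]; simp
          simp [this] at h2
        obtain ⟨κ, hκ, hc, q', h1, h2, h3, h4⟩ := hP.exists_step hW hu hxW hx harc q hq hS
        have hk : (((1 <<< (c + (l + w) % 4)) |||
            adj.arrivals f (vis ||| (1 <<< x)) x ((l + w) % 4)) ||| _).testBit k = true := hk
        simp only [Nat.testBit_or, Bool.or_eq_true] at hk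
        rcases hk with (hk | hk) | hk
        · rw [Nat.one_shiftLeft, Nat.testBit_two_pow, decide_eq_true_eq] at hk
          exact ⟨x, κ, (l + w) % 4, hκ, Nat.mod_lt _ (by omega), by omega, q', h1, by omega, h4⟩
        · refine ih (vis ||| (1 <<< x)) x ((l + w) % 4) (insert x W) (fun y => ?_) ?_
            (Set.mem_insert _ _) q' h1 (by omega) h3 k hk
          · rw [Nat.testBit_or, Bool.or_eq_true, Nat.one_shiftLeft, Nat.testBit_two_pow,
              decide_eq_true_eq, hvis, Set.mem_insert_iff]
            tauto
          · rintro y (rfl | hy)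
            · exact hx
            · exact hW y hy
        · exact iht htail hk
      · rw [hland] at hk
        exact iht htail hk

theorem IsPicture.of_testBit_allArrivals (hP : D.IsPicture H p t adj line) {s : ℕ}
    (hs : s < adj.length) {k : ℕ} (hk : (adj.allArrivals s).testBit k = true) :
    ∃ x κ m, κ < 3 ∧ m < 4 ∧ k = 12 * x + 4 * κ + m ∧ D.IsArrival H p t line s x κ m := by
  have hk : ((1 <<< (12 * s)) ||| adj.arrivals 20 (1 <<< s) s 0).testBit k = true := hk
  simp only [Nat.testBit_or, Bool.or_eq_true] at hk
  rcases hk with hk | hk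
  · rw [Nat.one_shiftLeft, Nat.testBit_two_pow, decide_eq_true_eq] at hk
    refine ⟨s, 0, 0, by omega, by omega, by omega, .nil, .nil, rfl, ?_, ?_⟩
    · intro _ hsl k h1 h2 _ hk
      have := (hP.mem_of_node_eq hs h2 (by simpa using Eq.symm (by simpa using hk))).2
      omega
    · intro _ hsl k h1 _ hk
      have := hP.height_le s hsl
      have := (hP.mem_of_node_eq hs (k := k) (by omega)
        (by simpa using Eq.symm (by simpa using hk))).2
      omega
  · refine hP.of_testBit_arrivals 20 (1 <<< s) s 0 {s} (fun x => ?_) (by simpa using hs) rfl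
      .nil .nil rfl (fun v hv => .inl ⟨s, rfl, by simpa using hv⟩) k hk
    rw [Nat.one_shiftLeft, Nat.testBit_two_pow, decide_eq_true_eq, Set.mem_singleton_iff, eq_comm]

end Layout

/-! ### Blocked chords close cycles of length 2 mod 4 -/

theorem exists_testBit_of_not_beq_land {F m c : ℕ}
    (h : (!Nat.beq (Nat.land F (Nat.shiftLeft m c)) 0) = true) :
    ∃ j, m.testBit j = true ∧ F.testBit (c + j) = true := by
  have hne : F &&& (m <<< c) ≠ 0 := by
    intro h0
    rw [show Nat.land F (Nat.shiftLeft m c) = 0 from h0] at h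
    simp at h
  obtain ⟨k, hk⟩ := Nat.exists_testBit_of_ne_zero hne
  rw [Nat.testBit_and, Bool.and_eq_true, Nat.testBit_shiftLeft, Bool.and_eq_true,
    decide_eq_true_eq] at hk
  exact ⟨k - c, hk.2.2, by rw [Nat.add_sub_cancel' hk.2.1]; exact hk.1⟩

namespace Layout

variable {V : Type*} {D : Layout V} {G H : SimpleGraph V} {p : ℕ → V} {t : ℕ} {adj : ArcTable}
  {line : List (ℕ × ℕ)}

theorem IsPicture.hasCycleMod_of_blocked (hP : D.IsPicture H p t adj line) (hHG : H ≤ G) {s u : ℕ}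
    (hs : s < adj.length) (hG : G.Adj (D.node s) (D.node u)) (hH : ¬ H.Adj (D.node s) (D.node u))
    (hb : blocked (adj.allArrivals s) u = true) : G.HasCycleMod 2 4 := by
  obtain ⟨j, hj, hk⟩ := exists_testBit_of_not_beq_land hb
  obtain ⟨x, κ, m, hκ, hm, he, q, h1, h2, -⟩ := hP.of_testBit_allArrivals hs hk
  have hj10 : j < 10 := by
    by_contra hlt
    rw [Nat.testBit_eq_false_of_lt (lt_of_lt_of_le (by norm_num)
      (Nat.pow_le_pow_right (by norm_num) (not_lt.1 hlt)) : 546 < 2 ^ j)] at hj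
    simp at hj
  -- `546 = 2^1 + 2^5 + 2^9`: length 1 mod 4 with any of the three kinds of arrival.
  have hj' : j = 1 ∨ j = 5 ∨ j = 9 := by
    interval_cases j <;> revert hj <;> decide
  obtain rfl : x = u := by omega
  exact SimpleGraph.hasCycleMod_of_isPath hHG q h1 (by omega) hG hH

theorem IsPicture.hasCycleMod_of_blockedGap (hP : D.IsPicture H p t adj line) (hHG : H ≤ G)
    {s h u ru : ℕ} {l₁ l₂ : List (ℕ × ℕ)} (hl : line = l₁ ++ (u, ru) :: l₂)
    (hu : D.height u < h) (ht : h ≤ t) (hl₂ : ∀ b ∈ l₂, h < D.height b.1)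
    (hs : s < adj.length) (hG : G.Adj (D.node s) (p h)) (hH : ¬ H.Adj (D.node s) (p h))
    (hb : blockedGap (adj.allArrivals s) line l₁.length (h % 4) = true) :
    G.HasCycleMod 2 4 := by
  have hsort := hP.sorted
  have hmem : ∀ a ∈ line.map Prod.fst, a ∈ l₁.map Prod.fst ∨ a = u ∨ a ∈ l₂.map Prod.fst := by
    intro a ha
    simpa [hl, or_assoc] using ha
  have hul : u ∈ line.map Prod.fst := by simp [hl]
  have hru : ru = D.height u % 4 := hP.residue (u, ru) (by simp [hl])
  have hlow : ∀ a ∈ l₁.map Prod.fst, D.height a < D.height u := by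
    intro a ha
    obtain ⟨b, hb, rfl⟩ := List.mem_map.1 ha
    rw [hl, List.pairwise_append] at hsort
    exact hsort.2.2 b hb _ (List.mem_cons_self ..)
  have hhigh : ∀ a ∈ l₂.map Prod.fst, h < D.height a := by
    intro a ha
    obtain ⟨b, hb, rfl⟩ := List.mem_map.1 ha
    exact hl₂ b hb
  unfold blockedGap at hb
  rw [hl, List.drop_left] at hb
  simp only [Bool.or_eq_true] at hb
  rcases hb with hb | hb
  · obtain ⟨j, hj, hk⟩ := exists_testBit_of_not_beq_land hb
    obtain ⟨x, κ, m, hκ, hm, he, q, h1, h2, h3⟩ := hP.of_testBit_allArrivals hs hk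
    have hj10 : j < 5 := by
      by_contra hlt
      rw [Nat.testBit_eq_false_of_lt (lt_of_lt_of_le (by norm_num)
        (Nat.pow_le_pow_right (by norm_num) (not_lt.1 hlt)) : 17 < 2 ^ j)] at hj
      simp at hj
    have hj' : j = 0 ∨ j = 4 := by
      interval_cases j <;> revert hj <;> decide
    obtain rfl : x = u := by omega
    -- The arrival was not from above, so the path can be continued up the line from `x` to height
    -- `h`.
    obtain ⟨n, rfl⟩ : ∃ n, h = D.height x + n := ⟨_, (Nat.add_sub_cancel' hu.le).symm⟩
    obtain ⟨q', h4, h5, -⟩ := SimpleGraph.Walk.IsPath.exists_extend_up hP.path hP.path_inj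
      (q.copy rfl (hP.node_eq x hul)) (by simpa using h1) n ht fun k hk1 hk2 hmem' => by
        refine h3.1 (by omega) hul k hk1 (by omega) (fun a ha => ?_) (by simpa using hmem')
        rcases hmem a ha with ha | rfl | ha
        · exact .inl (hlow a ha).le
        · exact .inl le_rfl
        · exact .inr (by have := hhigh a ha; omega)
    refine SimpleGraph.hasCycleMod_of_isPath hHG q' h4 ?_ hG hH
    rw [h5, SimpleGraph.Walk.length_copy]
    omega
  · rcases l₂ with _ | ⟨⟨v, rv⟩, l₃⟩
    · simp at hb
    · simp only at hb
      obtain ⟨j, hj, hk⟩ := exists_testBit_of_not_beq_land hb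
      obtain ⟨x, κ, m, hκ, hm, he, q, h1, h2, h3⟩ := hP.of_testBit_allArrivals hs hk
      have hvl : v ∈ line.map Prod.fst := by simp [hl]
      have hrv : rv = D.height v % 4 := hP.residue (v, rv) (by simp [hl])
      have hv : h < D.height v := hl₂ (v, rv) (by simp)
      have hj10 : j < 9 := by
        by_contra hlt
        rw [Nat.testBit_eq_false_of_lt (lt_of_lt_of_le (by norm_num)
          (Nat.pow_le_pow_right (by norm_num) (not_lt.1 hlt)) : 257 < 2 ^ j)] at hj
        simp at hj
      have hj' : j = 0 ∨ j = 8 := by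
        interval_cases j <;> revert hj <;> decide
      obtain rfl : x = v := by omega
      obtain ⟨n, hn⟩ : ∃ n, D.height x = h + n := ⟨_, (Nat.add_sub_cancel' hv.le).symm⟩
      have hxt := hP.height_le x hvl
      have ex : D.node x = p (h + n) := by rw [hP.node_eq x hvl, hn]
      obtain ⟨q', h4, h5, -⟩ := SimpleGraph.Walk.IsPath.exists_extend_down hP.path hP.path_inj n
        (q.copy rfl ex) (by simpa using h1) (by omega) fun k hk1 hk2 hmem' => by
          refine h3.2 (by omega) hvl k (by omega) (fun a ha => ?_) (by simpa using hmem')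
          rcases hmem a ha with ha | rfl | ha
          · exact .inr (by have := hlow a ha; omega)
          · exact .inr (by omega)
          · rw [List.map_cons, List.mem_cons] at ha
            rcases ha with rfl | ha
            · exact .inl le_rfl
            · obtain ⟨b, hb, rfl⟩ := List.mem_map.1 ha
              rw [hl, List.pairwise_append, List.pairwise_cons, List.pairwise_cons] at hsort
              exact .inl (hsort.2.1.2.1 b hb).le
      refine SimpleGraph.hasCycleMod_of_isPath hHG q' h4 ?_ hG hH
      rw [h5, SimpleGraph.Walk.length_copy]
      omega

/-! ### Placing a chord preserves the interpretation -/

theorem IsArc.mono {H' : SimpleGraph V} (h : H ≤ H') {u x w c : ℕ} (ha : D.IsArc H line u x w c) :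
    D.IsArc H' line u x w c := by
  rcases ha with ⟨h1, h2, h3⟩ | ha | ha
  · exact .inl ⟨h1, h2, h h3⟩
  · exact .inr (.inl ha)
  · exact .inr (.inr ha)

theorem IsPicture.addEdge (hP : D.IsPicture H p t adj line) {H' : SimpleGraph V} (hH : H ≤ H')
    {u v : ℕ} (hu : u < adj.length) (hv : v < adj.length) (huv : H'.Adj (D.node u) (D.node v)) :
    D.IsPicture H' p t (adj.addEdge u v) line := by
  have hlen := ArcTable.length_addEdge adj u v
  have hne : u ≠ v := fun h => huv.ne (by rw [h])
  refine ⟨hP.sorted, by simpa only [hlen] using hP.lt_length, hP.residue, hP.node_eq,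
    hP.height_le, by simpa only [hlen] using hP.inj, by simpa only [hlen] using hP.off, ?_,
    fun i hi => hH (hP.path i hi), hP.path_inj⟩
  intro a ha
  rw [hlen] at ha ⊢
  have hold := (hP.arcs a ha).imp fun x w c h => (⟨h.1, h.2.mono hH⟩ :
    x < adj.length ∧ D.IsArc H' line a x w c)
  unfold ArcTable.addEdge
  by_cases hau : a = u
  · subst hau
    rw [ArcTable.look_update_self _ (by simpa using ha), ArcTable.look_update_of_ne _ _ hne]
    exact ⟨⟨hv, .inl ⟨rfl, rfl, huv⟩⟩, hold⟩
  · rw [ArcTable.look_update_of_ne _ _ hau]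
    by_cases hav : a = v
    · subst hav
      rw [ArcTable.look_update_self _ ha]
      exact ⟨⟨hu, .inl ⟨rfl, rfl, huv.symm⟩⟩, hold⟩
    · rw [ArcTable.look_update_of_ne _ _ hav]
      exact hold

/-- Interpret `n` as the vertex `v` at the given height. -/
def set (D : Layout V) (n : ℕ) (v : V) (h : ℕ) : Layout V :=
  ⟨Function.update D.node n v, Function.update D.height n h⟩

theorem set_node_self (n : ℕ) (v : V) (h : ℕ) : (D.set n v h).node n = v := by simp [set]

theorem set_height_self (n : ℕ) (v : V) (h : ℕ) : (D.set n v h).height n = h := by simp [set]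

theorem set_node_of_ne {n m : ℕ} (v : V) (h : ℕ) (hm : m ≠ n) :
    (D.set n v h).node m = D.node m := by simp [set, hm]

theorem set_height_of_ne {n m : ℕ} (v : V) (h : ℕ) (hm : m ≠ n) :
    (D.set n v h).height m = D.height m := by simp [set, hm]

/-- The only pair of neighbours on the line destroyed by a node at height `h` is the one with `h`
strictly between. Its two arcs are redirected to the new node, and all other arcs keep their
meaning. -/
theorem IsPicture.insertNode (hP : D.IsPicture H p t adj line) {h u ru : ℕ}
    {l₁ l₂ : List (ℕ × ℕ)} (hl : line = l₁ ++ (u, ru) :: l₂) (hu : D.height u < h) (ht : h ≤ t)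
    (hl₂ : ∀ b ∈ l₂, h < D.height b.1) :
    (D.set adj.length (p h) h).IsPicture H p t (adj.insertNode line l₁.length (h % 4))
      (l₁ ++ (u, ru) :: (adj.length, h % 4) :: l₂) := by
  set n := adj.length with hn
  set D' := D.set n (p h) h with hD'
  have hsort := hP.sorted
  have hlt : ∀ a ∈ line.map Prod.fst, a < n := fun a ha => hP.lt_of_mem ha
  have hmem : ∀ a, a ∈ line.map Prod.fst ↔
      (a ∈ l₁.map Prod.fst ∨ a = u ∨ a ∈ l₂.map Prod.fst) := by
    intro a
    simp [hl]
  have hmem' : ∀ a, a ∈ (l₁ ++ (u, ru) :: (n, h % 4) :: l₂).map Prod.fst ↔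
      (a ∈ line.map Prod.fst ∨ a = n) := by
    intro a
    rw [hmem]
    simp only [List.map_append, List.map_cons, List.mem_append, List.mem_cons]
    tauto
  have hul : u ∈ line.map Prod.fst := (hmem u).2 (.inr (.inl rfl))
  have hru : ru = D.height u % 4 := hP.residue (u, ru) (by simp [hl])
  have hlow : ∀ a ∈ l₁.map Prod.fst, D.height a < D.height u := by
    intro a ha
    obtain ⟨b, hb, rfl⟩ := List.mem_map.1 ha
    rw [hl, List.pairwise_append] at hsort
    exact hsort.2.2 b hb _ (List.mem_cons_self ..)
  have hhigh : ∀ a ∈ l₂.map Prod.fst, h < D.height a := by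
    intro a ha
    obtain ⟨b, hb, rfl⟩ := List.mem_map.1 ha
    exact hl₂ b hb
  have hnode : ∀ a < n, D'.node a = D.node a := fun a ha => set_node_of_ne _ _ ha.ne
  have hheight : ∀ a < n, D'.height a = D.height a := fun a ha => set_height_of_ne _ _ ha.ne
  have hnn : D'.node n = p h := set_node_self ..
  have hnh : D'.height n = h := set_height_self ..
  have hne : ∀ a ∈ line.map Prod.fst, D.height a ≠ h := by
    intro a ha
    rcases (hmem a).1 ha with ha | rfl | ha
    · have := hlow a ha; omega
    · omega
    · have := hhigh a ha; omega
  have hnew : ∀ a < n, D.node a ≠ p h := by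
    intro a ha he
    obtain ⟨h1, h2⟩ := hP.mem_of_node_eq ha ht he
    exact hne a h1 h2
  have hlen : (adj.insertNode line l₁.length (h % 4)).length = n + 1 := by
    unfold ArcTable.insertNode
    rw [hl, List.drop_left]
    rcases l₂ with _ | ⟨⟨v, rv⟩, l₃⟩ <;> simp [hn]
  -- Neighbours on the line with `h` between them can only be `u` and the first node of `l₂`.
  have hcons : ∀ a b, D.Consecutive line a b → D.height a < h → h < D.height b →
      a = u ∧ ∃ q l₃, l₂ = q :: l₃ ∧ b = q.1 := by
    intro a b hc h1 h2
    have hub := hc.2.2 u hul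
    have hau : a = u := by
      rcases (hmem a).1 hc.1.1 with ha | ha | ha
      · have := hlow a ha; omega
      · exact ha
      · have := hhigh a ha; omega
    refine ⟨hau, ?_⟩
    rcases (hmem b).1 hc.1.2 with hb | rfl | hb
    · have := hlow b hb; omega
    · omega
    · rcases l₂ with _ | ⟨q, l₃⟩
      · simp at hb
      · refine ⟨q, l₃, rfl, ?_⟩
        rw [List.map_cons, List.mem_cons] at hb
        rcases hb with hb | hb
        · exact hb
        · obtain ⟨b', hb', rfl⟩ := List.mem_map.1 hb
          rw [hl, List.pairwise_append, List.pairwise_cons, List.pairwise_cons] at hsort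
          have h3 := hsort.2.1.2.1 b' hb'
          have h4 := hl₂ q (by simp)
          have h5 := hc.2.2 q.1 ((hmem _).2 (.inr (.inr (by simp))))
          omega
  have hcons' : ∀ a b, D.Consecutive line a b → ¬ (D.height a < h ∧ h < D.height b) →
      D'.Consecutive (l₁ ++ (u, ru) :: (n, h % 4) :: l₂) a b := by
    intro a b hc hno
    have ha := hheight a (hlt a hc.1.1)
    have hb := hheight b (hlt b hc.1.2)
    refine ⟨⟨(hmem' _).2 (.inl hc.1.1), (hmem' _).2 (.inl hc.1.2)⟩, by rw [ha, hb]; exact hc.2.1,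
      fun c hcm => ?_⟩
    rw [ha, hb]
    rcases (hmem' _).1 hcm with hcm | rfl
    · rw [hheight c (hlt c hcm)]; exact hc.2.2 c hcm
    · rw [hnh]
      have := hne a hc.1.1
      have := hne b hc.1.2
      omega
  have hpersist : ∀ a < n, ∀ x w c, (x < n ∧ D.IsArc H line a x w c) →
      (∀ q l₃, l₂ = q :: l₃ → (a = u → c ≠ 12 * q.1 + 4) ∧ (a = q.1 → c ≠ 12 * u + 8)) →
      x < n + 1 ∧ D'.IsArc H (l₁ ++ (u, ru) :: (n, h % 4) :: l₂) a x w c := by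
    rintro a ha x w c ⟨hx, harc⟩ hno
    refine ⟨by omega, ?_⟩
    rcases harc with ⟨h1, h2, h3⟩ | ⟨h1, h2, h3⟩ | ⟨h1, h2, h3⟩
    · exact .inl ⟨h1, h2, by rw [hnode a ha, hnode x hx]; exact h3⟩
    · refine .inr (.inl ⟨h1, hcons' _ _ h2 fun h4 => ?_, by rw [hheight a ha, hheight x hx]; exact h3⟩)
      obtain ⟨rfl, q, l₃, h5, rfl⟩ := hcons _ _ h2 h4.1 h4.2
      exact (hno q l₃ h5).1 rfl h1
    · refine .inr (.inr ⟨h1, hcons' _ _ h2 fun h4 => ?_, by rw [hheight a ha, hheight x hx]; exact h3⟩)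
      obtain ⟨rfl, q, l₃, h5, rfl⟩ := hcons _ _ h2 h4.1 h4.2
      exact (hno q l₃ h5).2 rfl h1
  have hun := hlt u hul
  have hc1 : D'.Consecutive (l₁ ++ (u, ru) :: (n, h % 4) :: l₂) u n := by
    refine ⟨⟨(hmem' _).2 (.inl hul), (hmem' _).2 (.inr rfl)⟩, by rw [hheight u hun, hnh]; exact hu,
      fun c hcm => ?_⟩
    rw [hheight u hun, hnh]
    rcases (hmem' _).1 hcm with hcm | rfl
    · rw [hheight c (hlt c hcm)]
      rcases (hmem c).1 hcm with ha | rfl | ha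
      · have := hlow c ha; omega
      · omega
      · have := hhigh c ha; omega
    · omega
  refine ⟨?_, ?_, ?_, ?_, ?_, ?_, ?_, ?_, hP.path, hP.path_inj⟩
  · rw [hl, List.pairwise_append, List.pairwise_cons] at hsort
    rw [List.pairwise_append, List.pairwise_cons, List.pairwise_cons]
    have e1 : ∀ b ∈ l₁, D'.height b.1 = D.height b.1 := fun b hb =>
      hheight _ (hlt _ ((hmem _).2 (.inl (List.mem_map_of_mem hb))))
    have e2 : ∀ b ∈ l₂, D'.height b.1 = D.height b.1 := fun b hb =>
      hheight _ (hlt _ ((hmem _).2 (.inr (.inr (List.mem_map_of_mem hb)))))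
    have e3 := hheight u hun
    refine ⟨hsort.1.imp_of_mem fun ha hb hab => by rwa [e1 _ ha, e1 _ hb], ⟨?_, ?_, ?_⟩, ?_⟩
    · intro a ha
      rw [List.mem_cons] at ha
      rcases ha with rfl | ha
      · simpa only [e3, hnh] using hu
      · simpa only [e3, e2 a ha] using hsort.2.1.1 a ha
    · intro a ha
      simpa only [hnh, e2 a ha] using hl₂ a ha
    · exact hsort.2.1.2.imp_of_mem fun ha hb hab => by rwa [e2 _ ha, e2 _ hb]
    · intro a ha b hb
      rw [e1 a ha]
      have hau := hlow a.1 (List.mem_map_of_mem ha)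
      simp only [List.mem_cons] at hb
      rcases hb with rfl | rfl | hb
      · rw [e3]; exact hau
      · simp only [hnh]; omega
      · rw [e2 b hb]; have := hl₂ b hb; omega
  · intro a ha
    rw [hlen]
    rcases (hmem' a.1).1 (List.mem_map_of_mem ha) with ha | ha
    · have := hlt _ ha; omega
    · omega
  · intro a ha
    simp only [List.mem_append, List.mem_cons] at ha
    have key : ∀ b ∈ line, b.2 = D'.height b.1 % 4 := fun b hb => by
      rw [hheight _ (hlt _ (List.mem_map_of_mem hb))]; exact hP.residue b hb
    rcases ha with ha | rfl | rfl | ha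
    · exact key a (by simp [hl, ha])
    · exact key _ (by simp [hl])
    · simp only [hnh]
    · exact key a (by simp [hl, ha])
  · intro a ha
    rcases (hmem' a).1 ha with ha | rfl
    · rw [hnode a (hlt a ha), hheight a (hlt a ha)]; exact hP.node_eq a ha
    · rw [hnn, hnh]
  · intro a ha
    rcases (hmem' a).1 ha with ha | rfl
    · rw [hheight a (hlt a ha)]; exact hP.height_le a ha
    · rwa [hnh]
  · intro a ha b hb hab
    rw [hlen] at ha hb
    rcases (show a < n ∨ a = n by omega) with ha | rfl <;>
      rcases (show b < n ∨ b = n by omega) with hb | rfl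
    · rw [hnode a ha, hnode b hb] at hab
      exact hP.inj a ha b hb hab
    · rw [hnode a ha, hnn] at hab
      exact absurd hab (hnew a ha)
    · rw [hnode b hb, hnn] at hab
      exact absurd hab.symm (hnew b hb)
    · rfl
  · intro a ha hal k hk
    rw [hlen] at ha
    rw [hmem', not_or] at hal
    have ha : a < n := by have := hal.2; omega
    rw [hnode a ha]
    exact hP.off a ha hal.1 k hk
  · intro a ha
    rw [hlen] at ha ⊢
    have hgap : (D.height u + gapMod ru (h % 4)) % 4 = h % 4 := by unfold gapMod; omega
    unfold ArcTable.insertNode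
    rw [hl, List.drop_left]
    rcases l₂ with _ | ⟨⟨v, rv⟩, l₃⟩
    · simp only
      rcases (show a < n ∨ a = n by omega) with ha | rfl
      · rw [ArcTable.look_append_left _ _ (by simpa using ha)]
        have hold := (hP.arcs a ha).imp fun x w c hx => hpersist a ha x w c hx (by simp)
        by_cases hau : a = u
        · subst hau
          rw [ArcTable.look_update_self _ ha]
          exact ⟨⟨by omega, .inr (.inl ⟨rfl, hc1, by rw [hheight a ha, hnh]; exact hgap⟩)⟩, hold⟩
        · rw [ArcTable.look_update_of_ne _ _ hau]
          exact hold
      · have := ArcTable.look_append_length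
          (adj.update (.cons adj.length (gapMod ru (h % 4)) (12 * adj.length + 4)) u)
          (.cons u (gapMod ru (h % 4)) (12 * u + 8) .nil)
        rw [ArcTable.length_update] at this
        rw [hn, this]
        exact ⟨⟨by omega, .inr (.inr ⟨rfl, hc1, by rw [hheight u hun, hnh]; exact hgap⟩)⟩, trivial⟩
    · simp only
      have hvl : v ∈ line.map Prod.fst := by simp [hl]
      have hvn := hlt v hvl
      have hrv : rv = D.height v % 4 := hP.residue (v, rv) (by simp [hl])
      have hv : h < D.height v := hl₂ (v, rv) (by simp)
      have huv : u ≠ v := by rintro rfl; omega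
      have hgap2 : (h + gapMod (h % 4) rv) % 4 = D.height v % 4 := by unfold gapMod; omega
      have hc2 : D'.Consecutive (l₁ ++ (u, ru) :: (n, h % 4) :: (v, rv) :: l₃) n v := by
        refine ⟨⟨(hmem' _).2 (.inr rfl), (hmem' _).2 (.inl hvl)⟩,
          by rw [hheight v hvn, hnh]; exact hv, fun c hcm => ?_⟩
        rw [hheight v hvn, hnh]
        rcases (hmem' _).1 hcm with hcm | rfl
        · rw [hheight c (hlt c hcm)]
          rcases (hmem c).1 hcm with ha | rfl | ha
          · have := hlow c ha; omega
          · omega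
          · rw [List.map_cons, List.mem_cons] at ha
            rcases ha with rfl | ha
            · exact .inr le_rfl
            · obtain ⟨b', hb', rfl⟩ := List.mem_map.1 ha
              rw [hl, List.pairwise_append, List.pairwise_cons, List.pairwise_cons] at hsort
              exact .inr (hsort.2.1.2.1 b' hb').le
        · omega
      rcases (show a < n ∨ a = n by omega) with ha | rfl
      · rw [ArcTable.look_append_left _ _ (by simpa using ha)]
        have hold := hP.arcs a ha
        by_cases hau : a = u
        · subst hau
          rw [ArcTable.look_update_self _ (by simpa using ha), ArcTable.look_update_of_ne _ _ huv]
          refine hold.redirect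
            ⟨by omega, .inr (.inl ⟨rfl, hc1, by rw [hheight a ha, hnh]; exact hgap⟩)⟩
            fun x w c hc hx => hpersist a ha x w c hx fun q l hq => ?_
          obtain ⟨rfl, -⟩ := List.cons.inj hq
          exact ⟨fun _ => hc, fun h => absurd h huv⟩
        · rw [ArcTable.look_update_of_ne _ _ hau]
          by_cases hav : a = v
          · subst hav
            rw [ArcTable.look_update_self _ ha]
            refine hold.redirect
              ⟨by omega, .inr (.inr ⟨rfl, hc2, by rw [hheight a ha, hnh]; exact hgap2⟩)⟩
              fun x w c hc hx => hpersist a ha x w c hx fun q l hq => ?_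
            obtain ⟨rfl, -⟩ := List.cons.inj hq
            exact ⟨fun h => absurd h hau, fun _ => hc⟩
          · rw [ArcTable.look_update_of_ne _ _ hav]
            refine hold.imp fun x w c hx => hpersist a ha x w c hx fun q l hq => ?_
            obtain ⟨rfl, -⟩ := List.cons.inj hq
            exact ⟨fun h => absurd h hau, fun h => absurd h hav⟩
      · have := ArcTable.look_append_length
          (ArcTable.update (Row.redirect v adj.length (gapMod ru (h % 4)) 4)
            (ArcTable.update (Row.redirect u adj.length (gapMod (h % 4) rv) 8) adj v) u)
          (.cons u (gapMod ru (h % 4)) (12 * u + 8) (.cons v (gapMod (h % 4) rv) (12 * v + 4) .nil))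
        rw [ArcTable.length_update, ArcTable.length_update] at this
        rw [hn, this]
        exact ⟨⟨by omega, .inr (.inr ⟨rfl, hc1, by rw [hheight u hun, hnh]; exact hgap⟩)⟩,
          ⟨by omega, .inr (.inl ⟨rfl, hc2, by rw [hheight v hvn, hnh]; exact hgap2⟩)⟩, trivial⟩

end Layout

/-! ### Soundness of the search -/

/-- Used on the sorted line to find the last node below a given height: the end of the next chord is
then the following node or lies in the gap before it. -/
theorem List.exists_eq_append_cons_of_exists_lt {α : Type*} (f : α → ℕ) (h : ℕ) :
    ∀ l : List α, (∃ a ∈ l, f a < h) →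
      ∃ l₁ a l₂, l = l₁ ++ a :: l₂ ∧ f a < h ∧ ∀ b ∈ l₂, h ≤ f b
  | [], hl => by simp at hl
  | c :: l, hl => by
    by_cases hl' : ∃ a ∈ l, f a < h
    · obtain ⟨l₁, a, l₂, rfl, h1, h2⟩ := exists_eq_append_cons_of_exists_lt f h l hl'
      exact ⟨c :: l₁, a, l₂, rfl, h1, h2⟩
    · push Not at hl'
      obtain ⟨a, ha, h1⟩ := hl
      rcases List.mem_cons.1 ha with rfl | ha
      · exact ⟨[], a, l, rfl, h1, hl'⟩
      · have := hl' a ha; omega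

theorem ArcTable.length_insertNode (adj : ArcTable) (l₁ l₂ : List (ℕ × ℕ)) (a : ℕ × ℕ) (r : ℕ) :
    (adj.insertNode (l₁ ++ a :: l₂) l₁.length r).length = adj.length + 1 := by
  unfold ArcTable.insertNode
  rw [List.drop_left]
  obtain ⟨u, ru⟩ := a
  rcases l₂ with _ | ⟨⟨v, rv⟩, l₃⟩ <;> simp

/-- The lists `rs` of heights are admissible for the tasks `Ts` after `cnt` chords of the first
task and `tot` chords altogether, the last of which ends at the height `low`. -/
def FitsTasks (t : ℕ) : List ChordTask → List (List ℕ) → ℕ → ℕ → ℕ → Prop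
  | [], [], _, _, _ => True
  | T :: Ts, r :: rs, cnt, tot, low =>
    (T.atLeast ≤ cnt + r.length ∧ (T.exact = true → cnt + r.length ≤ T.atLeast) ∧
      T.total ≤ tot + r.length ∧ (low :: r).Pairwise (· < ·) ∧ ∀ h ∈ r, h ≤ t) ∧
    FitsTasks t Ts rs 0 (tot + r.length) (firstStart Ts)
  | _, _, _, _, _ => False

/-- These are the chords still to be placed. Deleting them from `G` leaves the graph that the
current state pictures a part of. -/
def chordEdges {V : Type*} (ν : ℕ → V) (p : ℕ → V) :
    List ChordTask → List (List ℕ) → List (Sym2 V)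
  | T :: Ts, r :: rs => r.map (fun h => s(ν T.node, p h)) ++ chordEdges ν p Ts rs
  | _, _ => []

theorem chordEdges_congr {V : Type*} {ν ν' p : ℕ → V} :
    ∀ {Ts : List ChordTask} {rs : List (List ℕ)}, (∀ T ∈ Ts, ν T.node = ν' T.node) →
      chordEdges ν p Ts rs = chordEdges ν' p Ts rs
  | [], _, _ => by simp [chordEdges]
  | _ :: _, [], _ => by simp [chordEdges]
  | T :: Ts, r :: rs, h => by
    rw [chordEdges, chordEdges, h T (by simp),
      chordEdges_congr fun T' hT' => h T' (List.mem_cons_of_mem _ hT')]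

namespace Layout

variable {V : Type*} {G : SimpleGraph V} {p : ℕ → V} {t : ℕ}

/-- The actual chords, listed in `rs`, select one branch of the search tree. Along it, the next
chord is either blocked, which yields the cycle, or is moved from the pending list into the picture.
Since no branch of a successful search survives, a blocked chord must be met. -/
theorem IsPicture.hasCycleMod_of_noPlacement (fuel : ℕ) :
    ∀ (D : Layout V) (Ts : List ChordTask) (rs : List (List ℕ)) (cnt tot li low : ℕ)
      (adj : ArcTable) (line : List (ℕ × ℕ)),
      noPlacement fuel Ts cnt tot li adj line = true →
      D.IsPicture (G.deleteEdges {e : Sym2 V | e ∈ chordEdges D.node p Ts rs}) p t adj line →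
      (∀ i < 4, (line)[i]? = some (i, i) ∧ D.height i = i) →
      (∀ T ∈ Ts, T.node < adj.length ∧ T.start < 4) →
      FitsTasks t Ts rs cnt tot low →
      (∃ a, (line)[li]? = some a ∧ D.height a.1 = low) →
      (chordEdges D.node p Ts rs).Nodup → (∀ e ∈ chordEdges D.node p Ts rs, e ∈ G.edgeSet) →
      G.HasCycleMod 2 4 := by
  induction fuel with
  | zero => intro D Ts rs cnt tot li low adj line h; simp [noPlacement] at h
  | succ f ih =>
    intro D Ts rs cnt tot li low adj line h hP hbase hTs hfit hli hnd hsub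
    unfold noPlacement at h
    rcases Ts with _ | ⟨T, Ts⟩
    · simp at h
    rcases rs with _ | ⟨r, rs⟩
    · exact absurd hfit (by simp [FitsTasks])
    obtain ⟨⟨h1, h2, h3, h4, h5⟩, hrest⟩ := hfit
    simp only [Bool.and_eq_true] at h
    have hTs' : ∀ T ∈ Ts, T.node < adj.length ∧ T.start < 4 :=
      fun T hT => hTs T (List.mem_cons_of_mem _ hT)
    obtain ⟨hTn, hTst⟩ := hTs T (by simp)
    rcases r with _ | ⟨k, r⟩
    · have hsw := h.1
      simp only [List.length_nil, Nat.add_zero] at h1 h3 hrest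
      rw [Nat.ble_eq_true_of_le h1, Nat.ble_eq_true_of_le h3] at hsw
      simp only [Bool.and_self, Bool.not_true, Bool.false_or] at hsw
      have hst : firstStart Ts < 4 := by
        rcases Ts with _ | ⟨T', Ts⟩
        · simp [firstStart]
        · exact (hTs' T' (by simp)).2
      simp only [chordEdges, List.map_nil, List.nil_append] at hP hnd hsub
      exact ih D Ts rs 0 tot (firstStart Ts) (firstStart Ts) adj line hsw hP hbase hTs' hrest
        ⟨_, hbase _ hst⟩ hnd hsub
    · have hpl := h.2
      rw [Bool.or_eq_true] at hpl
      have hpl := hpl.resolve_left fun hx => by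
        rw [Bool.and_eq_true, Nat.ble_eq] at hx
        have := h2 hx.1
        rw [List.length_cons] at this
        omega
      rw [List.all_eq_true] at hpl
      simp only [List.mem_range, Bool.and_eq_true, Bool.or_eq_true] at hpl
      rw [List.pairwise_cons, List.pairwise_cons] at h4
      have hlk : low < k := h4.1 k (by simp)
      have hkt : k ≤ t := h5 k (by simp)
      have hsort := hP.sorted
      obtain ⟨a, hai, hal⟩ := hli
      have hamem : a ∈ line := List.mem_of_getElem? hai
      obtain ⟨l₁, ⟨u, ru⟩, l₂, hl, hu, hl₂⟩ := List.exists_eq_append_cons_of_exists_lt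
        (fun a : ℕ × ℕ => D.height a.1) k line ⟨a, hamem, by omega⟩
      simp only at hu
      have hindex : ∀ i b, (line)[i]? = some b → D.height b.1 < k → i ≤ l₁.length := by
        intro i b hb hbk
        by_contra hlt
        rw [hl, List.getElem?_append_right (by omega), List.getElem?_cons,
          if_neg (by omega)] at hb
        have := hl₂ b (List.mem_of_getElem? hb)
        omega
      have hlil : li ≤ l₁.length := hindex li a hai (by omega)
      have hedge : s(D.node T.node, p k) ∈ G.edgeSet := hsub _ (by simp [chordEdges])
      have hGadj : G.Adj (D.node T.node) (p k) := hedge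
      -- A pending chord is absent from the pictured graph, so a path found there cannot use it.
      have hHno : ¬ (G.deleteEdges {e : Sym2 V | e ∈ chordEdges D.node p (T :: Ts) ((k :: r) :: rs)}).Adj
          (D.node T.node) (p k) := by
        rw [SimpleGraph.deleteEdges_adj]
        intro hx
        exact hx.2 (by simp [chordEdges])
      have hce : chordEdges D.node p (T :: Ts) ((k :: r) :: rs) =
          s(D.node T.node, p k) :: chordEdges D.node p (T :: Ts) (r :: rs) := by
        simp [chordEdges]
      rw [hce, List.nodup_cons] at hnd
      have hsub' : ∀ e ∈ chordEdges D.node p (T :: Ts) (r :: rs), e ∈ G.edgeSet :=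
        fun e he => hsub e (by rw [hce]; exact List.mem_cons_of_mem _ he)
      -- Placing the chord returns its edge to the graph, hence the old picture remains valid there.
      have hmono : G.deleteEdges {e : Sym2 V | e ∈ chordEdges D.node p (T :: Ts) ((k :: r) :: rs)} ≤
          G.deleteEdges {e : Sym2 V | e ∈ chordEdges D.node p (T :: Ts) (r :: rs)} := by
        refine SimpleGraph.deleteEdges_anti fun e he => ?_
        show _ ∈ chordEdges D.node p (T :: Ts) ((k :: r) :: rs)
        rw [hce]
        exact List.mem_cons_of_mem _ he
      have hHyes : (G.deleteEdges {e : Sym2 V | e ∈ chordEdges D.node p (T :: Ts) (r :: rs)}).Adj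
          (D.node T.node) (p k) := by
        rw [SimpleGraph.deleteEdges_adj]
        exact ⟨hGadj, hnd.1⟩
      have hfit' : FitsTasks t (T :: Ts) (r :: rs) (cnt + 1) (tot + 1) k := by
        refine ⟨⟨?_, fun hx => ?_, ?_, List.pairwise_cons.2 h4.2,
          fun h hh => h5 h (List.mem_cons_of_mem _ hh)⟩, ?_⟩
        · rw [List.length_cons] at h1; omega
        · have := h2 hx; rw [List.length_cons] at this; omega
        · rw [List.length_cons] at h3; omega
        · rw [List.length_cons] at hrest
          rwa [show tot + 1 + r.length = tot + (r.length + 1) by omega]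
      by_cases hex : ∃ b l₃, l₂ = b :: l₃ ∧ D.height b.1 = k
      · obtain ⟨b, l₃, rfl, hbk⟩ := hex
        have hget : (line)[l₁.length + 1]? = some b := by
          rw [hl, List.getElem?_append_right (by omega)]
          simp
        have hgetD : line.getD (l₁.length + 1) (0, 0) = b := by
          rw [List.getD_eq_getElem?_getD, hget]; rfl
        have hblen : l₁.length + 1 < line.length := by
          by_contra hx
          rw [List.getElem?_eq_none (by omega)] at hget
          simp at hget
        have hbl : b ∈ line := List.mem_of_getElem? hget
        have hpk : p k = D.node b.1 := by
          rw [hP.node_eq _ (List.mem_map_of_mem hbl), hbk]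
        have hstep := (hpl _ hblen).1
        rw [hgetD] at hstep
        rcases hstep with hx | hx | hx
        · rw [Nat.ble_eq] at hx; omega
        · rw [hpk] at hGadj hHno
          exact hP.hasCycleMod_of_blocked (SimpleGraph.deleteEdges_le _) hTn hGadj hHno hx
        · rw [hpk] at hHyes
          refine ih D (T :: Ts) (r :: rs) _ _ _ k _ line hx
            (hP.addEdge hmono hTn (hP.lt_length b hbl) hHyes) hbase ?_ hfit' ⟨b, hget, hbk⟩
            hnd.2 hsub'
          simpa only [ArcTable.length_addEdge] using hTs
      · have hl₂' : ∀ b ∈ l₂, k < D.height b.1 := by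
          intro b hb
          refine lt_of_le_of_ne (hl₂ b hb) fun he => ?_
          rcases l₂ with _ | ⟨c, l₃⟩
          · simp at hb
          · refine hex ⟨c, l₃, rfl, ?_⟩
            rcases List.mem_cons.1 hb with rfl | hb
            · exact he.symm
            · rw [hl, List.pairwise_append, List.pairwise_cons, List.pairwise_cons] at hsort
              have h6 := hsort.2.1.2.1 b hb
              have h7 := hl₂ c (by simp)
              omega
        -- Heights up to 3 are always marked, so an unmarked end lies above them.
        have h3k : 3 < k := by
          by_contra hx
          obtain ⟨hk1, hk2⟩ := hbase k (by omega)
          have hmem := List.mem_of_getElem? hk1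
          rw [hl, List.mem_append, List.mem_cons] at hmem
          rw [hl, List.pairwise_append] at hsort
          rcases hmem with hm | hm | hm
          · have := hsort.2.2 _ hm _ (List.mem_cons_self ..)
            simp only at this
            omega
          · obtain ⟨rfl, -⟩ := Prod.mk.inj hm
            omega
          · have := hl₂' _ hm
            simp only at this
            omega
        have h3l : 3 ≤ l₁.length := hindex 3 (3, 3) (hbase 3 (by omega)).1
          (by rw [(hbase 3 (by omega)).2]; exact h3k)
        have hnlen : 3 < adj.length :=
          hP.lt_length (3, 3) (List.mem_of_getElem? (hbase 3 (by omega)).1)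
        have hstep := (hpl l₁.length (by rw [hl]; simp)).2.resolve_left (by
          rw [Nat.ble_eq_true_of_le hlil, Nat.ble_eq_true_of_le h3l]
          simp)
        rw [List.all_eq_true] at hstep
        have hstep := hstep (k % 4) (by
          have : k % 4 < 4 := Nat.mod_lt _ (by omega)
          simp only [List.mem_cons, List.not_mem_nil, or_false]
          omega)
        rw [Bool.or_eq_true] at hstep
        rcases hstep with hx | hx
        · exact hP.hasCycleMod_of_blockedGap (SimpleGraph.deleteEdges_le _) hl hu hkt hl₂' hTn
            hGadj hHno hx
        · have hline : line.take (l₁.length + 1) ++ (adj.length, k % 4) ::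
              line.drop (l₁.length + 1) = l₁ ++ (u, ru) :: (adj.length, k % 4) :: l₂ := by
            have e : line = (l₁ ++ [(u, ru)]) ++ l₂ := by simp [hl]
            have e2 : l₁.length + 1 = (l₁ ++ [(u, ru)]).length := by simp
            rw [e2, e, List.take_left, List.drop_left]
            simp
          rw [hline] at hx
          have hP' := hP.insertNode hl hu hkt hl₂'
          have hnode : ∀ T' ∈ T :: Ts,
              (D.set adj.length (p k) k).node T'.node = D.node T'.node :=
            fun T' hT' => set_node_of_ne _ _ (hTs T' hT').1.ne
          have hcg : ∀ rs', chordEdges (D.set adj.length (p k) k).node p (T :: Ts) rs' =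
              chordEdges D.node p (T :: Ts) rs' := fun rs' => chordEdges_congr hnode
          have hlen : (adj.insertNode line l₁.length (k % 4)).length = adj.length + 1 := by
            rw [hl]; exact ArcTable.length_insertNode ..
          refine ih (D.set adj.length (p k) k) (T :: Ts) (r :: rs) _ _ _ k _ _ hx ?_ ?_ ?_ hfit'
            ?_ (by rw [hcg]; exact hnd.2) (by rw [hcg]; exact hsub')
          · rw [hcg]
            refine hP'.addEdge hmono (by omega) (by omega) ?_
            rw [hnode T (by simp), set_node_self]
            exact hHyes
          · intro i hi
            refine ⟨?_, ?_⟩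
            · rw [← (hbase i hi).1, hl]
              rcases (show i < l₁.length ∨ i = l₁.length by omega) with hi' | rfl
              · rw [List.getElem?_append_left hi', List.getElem?_append_left hi']
              · rw [List.getElem?_append_right le_rfl, List.getElem?_append_right le_rfl]
                simp
            · rw [set_height_of_ne _ _ (by omega)]
              exact (hbase i hi).2
          · intro T' hT'
            have := hTs T' hT'
            rw [ArcTable.length_addEdge, hlen]
            exact ⟨by omega, this.2⟩
          · refine ⟨(adj.length, k % 4), ?_, set_height_self ..⟩
            rw [List.getElem?_append_right (by omega)]
            simp

end Layout

/-! ### From sets of chord heights to the search -/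

/-- The totals demanded by the tasks `Ts` are reached if the task node `v` has chords to the heights
in `B v`, and `tot` chords have been placed before. -/
def ReachesTotals (B : ℕ → Finset ℕ) : List ChordTask → ℕ → Prop
  | [], _ => True
  | T :: Ts, tot => T.total ≤ tot + (B T.node).card ∧
    ReachesTotals B Ts (tot + (B T.node).card)

theorem fitsTasks_sort {B : ℕ → Finset ℕ} {t : ℕ} :
    ∀ {Ts : List ChordTask} {tot : ℕ}, ReachesTotals B Ts tot →
      (∀ T ∈ Ts, T.atLeast ≤ (B T.node).card ∧ (T.exact = true → (B T.node).card ≤ T.atLeast) ∧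
        ∀ h ∈ B T.node, T.start < h ∧ h ≤ t) →
      FitsTasks t Ts (Ts.map fun T => (B T.node).sort (· ≤ ·)) 0 tot (firstStart Ts)
  | [], _, _, _ => trivial
  | T :: Ts, tot, ht, h => by
    obtain ⟨h1, h2, h3⟩ := h T (by simp)
    refine ⟨⟨by simpa using h1, fun hx => by simpa using h2 hx, by simpa using ht.1,
      List.pairwise_cons.2 ⟨fun a ha => (h3 a (by simpa using ha)).1,
        Finset.sortedLT_sort (B T.node) |>.pairwise⟩, fun a ha => (h3 a (by simpa using ha)).2⟩, ?_⟩
    rw [Finset.length_sort]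
    exact fitsTasks_sort ht.2 fun T' hT' => h T' (List.mem_cons_of_mem _ hT')

theorem mem_chordEdges_sort {V : Type*} {ν p : ℕ → V} {B : ℕ → Finset ℕ} {e : Sym2 V} :
    ∀ {Ts : List ChordTask},
      e ∈ chordEdges ν p Ts (Ts.map fun T => (B T.node).sort (· ≤ ·)) ↔
        ∃ T ∈ Ts, ∃ h ∈ B T.node, e = s(ν T.node, p h)
  | [] => by simp [chordEdges]
  | T :: Ts => by
    rw [List.map_cons, chordEdges, List.mem_append, mem_chordEdges_sort]
    simp [eq_comm]

theorem nodup_chordEdges_sort {V : Type*} {ν p : ℕ → V} {B : ℕ → Finset ℕ} :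
    ∀ {Ts : List ChordTask}, (Ts.map ChordTask.node).Nodup →
      (∀ T ∈ Ts, ∀ T' ∈ Ts, ∀ h ∈ B T.node, ∀ h' ∈ B T'.node,
        s(ν T.node, p h) = s(ν T'.node, p h') → T.node = T'.node ∧ h = h') →
      (chordEdges ν p Ts (Ts.map fun T => (B T.node).sort (· ≤ ·))).Nodup
  | [], _, _ => by simp [chordEdges]
  | T :: Ts, hnd, hinj => by
    rw [List.map_cons, List.nodup_cons] at hnd
    rw [List.map_cons, chordEdges, List.nodup_append]
    refine ⟨?_, nodup_chordEdges_sort hnd.2 fun T₁ h₁ T₂ h₂ => hinj T₁ (List.mem_cons_of_mem _ h₁)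
      T₂ (List.mem_cons_of_mem _ h₂), ?_⟩
    · refine List.Nodup.map_on (fun a ha b hb hab => ?_) (Finset.sort_nodup _ _)
      exact (hinj T (by simp) T (by simp) a (by simpa using ha) b (by simpa using hb) hab).2
    · rintro e he _ he' rfl
      obtain ⟨T', hT', h', hh', rfl⟩ := mem_chordEdges_sort.1 he'
      obtain ⟨h, hh, he⟩ := List.mem_map.1 he
      have := (hinj T (by simp) T' (List.mem_cons_of_mem _ hT') h (by simpa using hh) h' hh' he).1
      exact hnd.1 (this ▸ List.mem_map_of_mem hT')

namespace Layout

variable {V : Type*} {D : Layout V} {H : SimpleGraph V} {p : ℕ → V} {t : ℕ}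

theorem IsPicture.foldr_addEdge {adj : ArcTable} {line : List (ℕ × ℕ)}
    (hP : D.IsPicture H p t adj line) :
    ∀ es : List (ℕ × ℕ),
      (∀ e ∈ es, e.1 < adj.length ∧ e.2 < adj.length ∧ H.Adj (D.node e.1) (D.node e.2)) →
      D.IsPicture H p t (es.foldr (fun e a => a.addEdge e.1 e.2) adj) line ∧
        (es.foldr (fun e a => a.addEdge e.1 e.2) adj).length = adj.length
  | [], _ => ⟨hP, rfl⟩
  | e :: es, h => by
    obtain ⟨h1, h2⟩ := hP.foldr_addEdge es fun e he => h e (List.mem_cons_of_mem _ he)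
    obtain ⟨h3, h4, h5⟩ := h e (by simp)
    exact ⟨h1.addEdge le_rfl (by rwa [h2]) (by rwa [h2]) h5, by
      rw [List.foldr_cons, ArcTable.length_addEdge, h2]⟩

theorem isPicture_replicate_nil {k : ℕ} {ν : ℕ → V} (ht : 3 ≤ t)
    (hp : ∀ i < t, H.Adj (p i) (p (i + 1))) (hinj : ∀ i ≤ t, ∀ j ≤ t, p i = p j → i = j)
    (hν : ∀ i < 4, ν i = p i) (hνinj : ∀ i < 4 + k, ∀ j < 4 + k, ν i = ν j → i = j)
    (hoff : ∀ i < 4 + k, 4 ≤ i → ∀ j ≤ t, ν i ≠ p j) :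
    (⟨ν, id⟩ : Layout V).IsPicture H p t (List.replicate (4 + k) Row.nil) baseLine := by
  have hmem : ∀ a, a ∈ baseLine.map Prod.fst ↔ a < 4 := by
    intro a
    simp [baseLine]
    omega
  have hlook : ∀ (n u : ℕ), ArcTable.look (List.replicate n Row.nil) u = .nil := by
    intro n
    induction n with
    | zero => intro u; rfl
    | succ n ih =>
      intro u
      rcases u with _ | u
      · rfl
      · exact ih u
  refine ⟨by simp [baseLine], ?_, by simp [baseLine], ?_, ?_, by simpa using hνinj, ?_, ?_, hp,
    hinj⟩
  · intro a ha
    have := (hmem a.1).1 (List.mem_map_of_mem ha)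
    simp
    omega
  · intro a ha
    exact hν a ((hmem a).1 ha)
  · intro a ha
    have := (hmem a).1 ha
    simp
    omega
  · intro u hu hul
    rw [hmem] at hul
    exact hoff u (by simpa using hu) (by omega)
  · intro u _
    rw [hlook]
    trivial

end Layout

/-- If the search succeeds, then a graph with a path `p 0, …, p t`, further vertices `ν 4, ν 5, …`
joined by the edges `es`, and chords as described by the tasks has a cycle of length `2` mod `4`. -/
theorem SimpleGraph.hasCycleMod_of_refuted {V : Type*} {G : SimpleGraph V} {k : ℕ}
    {es : List (ℕ × ℕ)} {Ts : List ChordTask} (h : refuted k es Ts = true) {p : ℕ → V} {t : ℕ}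
    (ht : 3 ≤ t) (hp : ∀ i < t, G.Adj (p i) (p (i + 1)))
    (hinj : ∀ i ≤ t, ∀ j ≤ t, p i = p j → i = j) {ν : ℕ → V}
    (hν : ∀ i < 4, ν i = p i) (hνinj : ∀ i < 4 + k, ∀ j < 4 + k, ν i = ν j → i = j)
    (hoff : ∀ i < 4 + k, 4 ≤ i → ∀ j ≤ t, ν i ≠ p j)
    (hes : ∀ e ∈ es, (4 ≤ e.2 ∧ e.1 < 4 + k ∧ e.2 < 4 + k ∧
      ∀ T ∈ Ts, T.node = e.2 → e.1 < 4 → e.1 ≤ T.start) ∧ G.Adj (ν e.1) (ν e.2))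
    (hnd : (Ts.map ChordTask.node).Nodup) (hTs : ∀ T ∈ Ts, T.node < 4 + k ∧ T.start < 4)
    {B : ℕ → Finset ℕ}
    (hB : ∀ T ∈ Ts, T.atLeast ≤ (B T.node).card ∧ (T.exact = true → (B T.node).card ≤ T.atLeast) ∧
      ∀ h ∈ B T.node, G.Adj (ν T.node) (p h) ∧ T.start < h ∧ h ≤ t ∧ (T.node < 4 → T.node + 1 < h))
    (htot : ReachesTotals B Ts 0) : G.HasCycleMod 2 4 := by
  have hoff' : ∀ i < 4 + k, ∀ j ≤ t, ν i = p j → i < 4 ∧ i = j := by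
    intro i hi j hj hij
    by_cases h4 : i < 4
    · exact ⟨h4, hinj i (by omega) j hj (by rw [← hν i h4, hij])⟩
    · exact absurd hij (hoff i hi (by omega) j hj)
  set E := chordEdges ν p Ts (Ts.map fun T => (B T.node).sort (· ≤ ·)) with hE
  -- No chord is an edge of the path: from the node `i < 4` the chords go to heights above `i + 1`,
  -- and the other nodes are off the path.
  have hpath : ∀ i < t, (G.deleteEdges {e | e ∈ E}).Adj (p i) (p (i + 1)) := by
    intro i hi
    refine SimpleGraph.deleteEdges_adj.2 ⟨hp i hi, fun hmem => ?_⟩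
    obtain ⟨T, hT, h, hh, he⟩ := mem_chordEdges_sort.1 hmem
    obtain ⟨-, -, h1⟩ := hB T hT
    obtain ⟨-, h2, h3, h4⟩ := h1 h hh
    rw [Sym2.eq_iff] at he
    rcases he with ⟨e1, e2⟩ | ⟨e1, e2⟩
    · obtain ⟨h5, h6⟩ := hoff' _ (hTs T hT).1 i hi.le e1.symm
      have := h4 h5
      have := hinj _ hi _ h3 e2
      omega
    · obtain ⟨h5, h6⟩ := hoff' _ (hTs T hT).1 (i + 1) hi e2.symm
      have := h4 h5
      have := hinj _ hi.le _ h3 e1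
      omega
  obtain ⟨hP, hlen⟩ := (Layout.isPicture_replicate_nil (k := k) ht hpath hinj hν hνinj
    hoff).foldr_addEdge ((0, 1) :: (1, 2) :: (2, 3) :: es) (by
      simp only [List.mem_cons, List.length_replicate]
      rintro e (rfl | rfl | rfl | he)
      · exact ⟨by omega, by omega, by
          simp only [hν 0 (by omega), hν 1 (by omega)]
          exact hpath 0 (by omega)⟩
      · exact ⟨by omega, by omega, by
          simp only [hν 1 (by omega), hν 2 (by omega)]
          exact hpath 1 (by omega)⟩
      · exact ⟨by omega, by omega, by
          simp only [hν 2 (by omega), hν 3 (by omega)]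
          exact hpath 2 (by omega)⟩
      · obtain ⟨⟨h1, h2, h3, h4⟩, h5⟩ := hes e he
        refine ⟨h2, h3, SimpleGraph.deleteEdges_adj.2 ⟨h5, fun hmem => ?_⟩⟩
        obtain ⟨T, hT, h, hh, he⟩ := mem_chordEdges_sort.1 hmem
        obtain ⟨-, -, h6⟩ := hB T hT
        obtain ⟨-, h7, h8, h9⟩ := h6 h hh
        rw [Sym2.eq_iff] at he
        rcases he with ⟨e1, e2⟩ | ⟨e1, e2⟩
        · have := (hoff' _ h3 _ h8 e2).1
          omega
        · have e3 := hνinj _ h3 _ (hTs T hT).1 e2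
          obtain ⟨e4, e5⟩ := hoff' _ h2 _ h8 e1
          have := h4 T hT e3.symm e4
          omega)
  refine Layout.IsPicture.hasCycleMod_of_noPlacement 100 ⟨ν, id⟩ Ts
    (Ts.map fun T => (B T.node).sort (· ≤ ·)) 0 0 (firstStart Ts) (firstStart Ts) _ _ h hP ?_ ?_
    (fitsTasks_sort htot fun T hT => ⟨(hB T hT).1, (hB T hT).2.1, fun h hh =>
      ⟨((hB T hT).2.2 h hh).2.1, ((hB T hT).2.2 h hh).2.2.1⟩⟩) ?_ ?_ ?_
  · intro i hi
    interval_cases i <;> simp [baseLine]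
  · rw [baseTable, hlen]
    simpa using hTs
  · have : firstStart Ts < 4 := by
      rcases Ts with _ | ⟨T, Ts⟩
      · simp [firstStart]
      · exact (hTs T (by simp)).2
    refine ⟨(firstStart Ts, firstStart Ts), ?_, rfl⟩
    generalize firstStart Ts = i at this
    interval_cases i <;> simp [baseLine]
  · refine nodup_chordEdges_sort hnd fun T hT T' hT' h hh h' hh' he => ?_
    obtain ⟨-, -, h1⟩ := hB T hT
    obtain ⟨-, h2, h3, h4⟩ := h1 h hh
    obtain ⟨-, -, h5⟩ := hB T' hT'
    obtain ⟨-, h6, h7, h8⟩ := h5 h' hh'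
    rw [Sym2.eq_iff] at he
    rcases he with ⟨e1, e2⟩ | ⟨e1, e2⟩
    · exact ⟨hνinj _ (hTs T hT).1 _ (hTs T' hT').1 e1, hinj _ h3 _ h7 e2⟩
    -- Two chords equal in reversed order would each have their task node below the other's, which
    -- is absurd.
    · obtain ⟨f1, f2⟩ := hoff' _ (hTs T hT).1 _ h7 e1
      obtain ⟨f3, f4⟩ := hoff' _ (hTs T' hT').1 _ h3 e2.symm
      have := h4 f1
      have := h8 f3
      omega
  · intro e he
    obtain ⟨T, hT, h, hh, rfl⟩ := mem_chordEdges_sort.1 he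
    exact ((hB T hT).2.2 h hh).1

/-! ### Critical graphs and longest paths -/

namespace SimpleGraph

variable {V : Type*} {G : SimpleGraph V} {p : ℕ → V} {t : ℕ}

/-- The edges with an end in `S`. -/
def edgesMeeting (G : SimpleGraph V) (S : Finset V) : Set (Sym2 V) :=
  {e ∈ G.edgeSet | ∃ v ∈ S, v ∈ e}

/-- `G` has no cycle of length `2` mod `4`, and no set of vertices can be deleted without lowering
the density below `5 / 2`. -/
structure IsCritical [Fintype V] (G : SimpleGraph V) : Prop where
  not_hasCycleMod : ¬ G.HasCycleMod 2 4
  lt_ncard : ∀ S : Finset V, S.Nonempty → (∃ v, v ∉ S) → 5 * S.card < 2 * (G.edgesMeeting S).ncard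

/-- The vertices `p 0, …, p t` form a path, and there is no path with one more vertex. -/
structure IsLongestPath (G : SimpleGraph V) (p : ℕ → V) (t : ℕ) : Prop where
  adj : ∀ i < t, G.Adj (p i) (p (i + 1))
  inj : ∀ i ≤ t, ∀ j ≤ t, p i = p j → i = j
  max : ∀ q : ℕ → V, (∀ i < t + 1, G.Adj (q i) (q (i + 1))) →
    ¬ ∀ i ≤ t + 1, ∀ j ≤ t + 1, q i = q j → i = j

open scoped Classical in
/-- The positions after `s` of the neighbours of `v` on the path `p 0, …, p t`. -/
noncomputable def heightsAfter (G : SimpleGraph V) (p : ℕ → V) (t : ℕ) (v : V) (s : ℕ) :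
    Finset ℕ :=
  (Finset.Ioc s t).filter fun j => G.Adj v (p j)

theorem mem_heightsAfter {v : V} {s j : ℕ} :
    j ∈ G.heightsAfter p t v s ↔ s < j ∧ j ≤ t ∧ G.Adj v (p j) := by
  simp [heightsAfter, and_assoc]

theorem card_heightsAfter_le (v : V) (s : ℕ) :
    (G.heightsAfter p t v s).card ≤ (G.heightsAfter p t v (s + 1)).card + 1 := by
  classical
  refine (Finset.card_le_card fun j hj => ?_).trans
    (Finset.card_insert_le (s + 1) (G.heightsAfter p t v (s + 1)))
  rw [Finset.mem_insert, mem_heightsAfter]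
  rw [mem_heightsAfter] at hj
  by_cases h : j = s + 1
  · exact .inl h
  · exact .inr ⟨by omega, hj.2⟩

theorem card_heightsAfter_le_sub (v : V) (s : ℕ) : (G.heightsAfter p t v s).card ≤ t - s := by
  rw [← Nat.card_Ioc]
  refine Finset.card_le_card fun j hj => ?_
  rw [mem_heightsAfter] at hj
  exact Finset.mem_Ioc.2 ⟨hj.1, hj.2.1⟩

/-- Charge each edge meeting `S` to an end whose set `up` contains the other end; the hypothesis
says that such an end exists in `S`. -/
theorem ncard_edgesMeeting_le (S : Finset V) (up : V → Finset V)
    (h : ∀ v ∈ S, ∀ u, G.Adj v u → u ∈ up v ∨ (u ∈ S ∧ v ∈ up u)) :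
    (G.edgesMeeting S).ncard ≤ ∑ v ∈ S, (up v).card := by
  classical
  have hsub : G.edgesMeeting S ⊆ ↑(S.biUnion fun v => (up v).image fun u => s(v, u)) := by
    rintro e ⟨he, v, hv, hve⟩
    obtain ⟨u, rfl⟩ := Sym2.mem_iff_exists.1 hve
    rw [Finset.mem_coe, Finset.mem_biUnion]
    rcases h v hv u he with h1 | ⟨h1, h2⟩
    · exact ⟨v, hv, Finset.mem_image_of_mem _ h1⟩
    · exact ⟨u, h1, Finset.mem_image.2 ⟨v, h2, Sym2.eq_swap⟩⟩
  refine (Set.ncard_le_ncard hsub (Finset.finite_toSet _)).trans ?_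
  rw [Set.ncard_coe_finset]
  exact Finset.card_biUnion_le.trans (Finset.sum_le_sum fun v _ => Finset.card_image_le)

theorem IsCritical.lt_sum [Fintype V] (hG : G.IsCritical) (S : Finset V) (up : V → Finset V)
    (hS : S.Nonempty) (hS' : ∃ v, v ∉ S)
    (h : ∀ v ∈ S, ∀ u, G.Adj v u → u ∈ up v ∨ (u ∈ S ∧ v ∈ up u)) :
    5 * S.card < 2 * ∑ v ∈ S, (up v).card := by
  have h1 := hG.lt_ncard S hS hS'
  have h2 := ncard_edgesMeeting_le S up h
  omega

/-- If all neighbours of the vertices `ν i` are on the path after `s i`, or below them among the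
`ν j`, then the `ν i` have many neighbours further up on the path. -/
theorem IsCritical.lt_sum_heightsAfter [Fintype V] (hG : G.IsCritical) (I : Finset ℕ) (ν : ℕ → V)
    (s : ℕ → ℕ) (hI : I.Nonempty) (hν : Set.InjOn ν I) (hout : ∃ v, ∀ i ∈ I, ν i ≠ v)
    (h : ∀ i ∈ I, ∀ u, G.Adj (ν i) u → (∃ j, s i < j ∧ j ≤ t ∧ u = p j) ∨
      ∃ i' ∈ I, u = ν i' ∧ ∃ j, s i' < j ∧ j ≤ t ∧ ν i = p j) :
    3 * I.card < 2 * ∑ i ∈ I, (G.heightsAfter p t (ν i) (s i + 1)).card := by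
  classical
  let σ : V → ℕ := Function.invFunOn ν I
  have hσ : ∀ i ∈ I, σ (ν i) = i := fun i hi =>
    hν (Function.invFunOn_mem ⟨i, hi, rfl⟩) hi (Function.invFunOn_eq ⟨i, hi, rfl⟩)
  have key := hG.lt_sum (I.image ν) (fun v => (G.heightsAfter p t v (s (σ v))).image p)
    (hI.image ν) (by
      obtain ⟨v, hv⟩ := hout
      exact ⟨v, by simpa using hv⟩) (by
      intro v hv u hvu
      obtain ⟨i, hi, rfl⟩ := Finset.mem_image.1 hv
      rcases h i hi u hvu with ⟨j, h1, h2, rfl⟩ | ⟨i', hi', rfl, j, h1, h2, h3⟩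
      · exact .inl (Finset.mem_image_of_mem _ (mem_heightsAfter.2 ⟨by rwa [hσ i hi], h2, hvu⟩))
      · refine .inr ⟨Finset.mem_image_of_mem _ hi', Finset.mem_image.2 ⟨j, ?_, h3.symm⟩⟩
        exact mem_heightsAfter.2 ⟨by rwa [hσ i' hi'], h2, h3 ▸ hvu.symm⟩)
  rw [Finset.card_image_of_injOn hν, Finset.sum_image hν] at key
  -- One edge per vertex may go to the height `s i + 1`, as the path edge does. Subtracting these
  -- from the bound turns `5|I|` into `3|I|`.
  have h2 : ∑ i ∈ I, ((G.heightsAfter p t (ν i) (s (σ (ν i)))).image p).card ≤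
      ∑ i ∈ I, ((G.heightsAfter p t (ν i) (s i + 1)).card + 1) := by
    refine Finset.sum_le_sum fun i hi => ?_
    rw [hσ i hi]
    exact Finset.card_image_le.trans (card_heightsAfter_le _ _)
  rw [Finset.sum_add_distrib, Finset.sum_const, smul_eq_mul, mul_one] at h2
  omega

/-- All neighbours of the end of another longest path are on this path. -/
theorem IsLongestPath.neighbor_cases (hp : G.IsLongestPath p t) (f : ℕ → V) {m : ℕ} (hm : 0 < m)
    (hf : ∀ i, i + 1 < m → G.Adj (f i) (f (i + 1))) (hlast : G.Adj (f (m - 1)) (p m))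
    (hinj : ∀ i < m, ∀ j < m, f i = f j → i = j)
    (hoff : ∀ i < m, ∀ j, m ≤ j → j ≤ t → f i ≠ p j) {w : V} (hw : G.Adj (f 0) w) :
    (∃ i < m, 0 < i ∧ w = f i) ∨ ∃ j, m ≤ j ∧ j ≤ t ∧ w = p j := by
  by_contra hno
  push Not at hno
  obtain ⟨h1, h2⟩ := hno
  have h1' : ∀ i < m, w ≠ f i := by
    intro i hi
    rcases Nat.eq_zero_or_pos i with rfl | h0
    · exact hw.ne'
    · exact h1 i hi h0
  set q : ℕ → V := fun i => if i < m then f i else p i with hq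
  have hq1 : ∀ i < m, q i = f i := fun i hi => if_pos hi
  have hq2 : ∀ i, m ≤ i → q i = p i := fun i hi => if_neg (by omega)
  have hqadj : ∀ i < t, G.Adj (q i) (q (i + 1)) := by
    intro i hi
    rcases lt_trichotomy (i + 1) m with h | h | h
    · rw [hq1 i (by omega), hq1 _ h]; exact hf i h
    · rw [hq1 i (by omega), hq2 _ (by omega), h, show i = m - 1 by omega]; exact hlast
    · rw [hq2 i (by omega), hq2 _ (by omega)]; exact hp.adj i hi
  have hqinj : ∀ i ≤ t, ∀ j ≤ t, q i = q j → i = j := by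
    intro i hi j hj hij
    rcases lt_or_ge i m with h | h <;> rcases lt_or_ge j m with h' | h'
    · rw [hq1 i h, hq1 j h'] at hij; exact hinj i h j h' hij
    · rw [hq1 i h, hq2 j h'] at hij; exact absurd hij (hoff i h j h' hj)
    · rw [hq2 i h, hq1 j h'] at hij; exact absurd hij.symm (hoff j h' i h hi)
    · rw [hq2 i h, hq2 j h'] at hij; exact hp.inj i hi j hj hij
  have hwq : ∀ i ≤ t, w ≠ q i := by
    intro i hi
    rcases lt_or_ge i m with h | h
    · rw [hq1 i h]; exact h1' i h
    · rw [hq2 i h]; exact h2 i h hi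
  -- Putting `w` in front of the other longest path would give a longer one.
  refine hp.max (fun i => Nat.casesOn i w q) ?_ ?_
  · rintro (_ | i) hi
    · change G.Adj w (q 0)
      rw [hq1 0 hm]
      exact hw.symm
    · exact hqadj i (by omega)
  · rintro (_ | i) hi (_ | j) hj hij
    · rfl
    · exact absurd hij (hwq j (by omega))
    · exact absurd hij.symm (hwq i (by omega))
    · rw [hqinj i (by omega) j (by omega) hij]

/-- The neighbours of `p 0` are on the path. -/
theorem IsLongestPath.exists_eq_of_adj_zero (hp : G.IsLongestPath p t) (ht : 0 < t) {w : V}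
    (hw : G.Adj (p 0) w) : ∃ j, 0 < j ∧ j ≤ t ∧ w = p j := by
  have hoff : ∀ i < 1, ∀ j, 1 ≤ j → j ≤ t → p i ≠ p j := fun i hi j hj hjt he => by
    have := hp.inj i (by omega) j hjt he
    omega
  rcases hp.neighbor_cases p one_pos (fun i hi => by omega) (hp.adj 0 ht)
    (fun i hi j hj _ => by omega) hoff hw with ⟨i, h1, h2, -⟩ | h
  · omega
  · exact h

theorem IsLongestPath.exists_eq_of_adj_leaf (hp : G.IsLongestPath p t) {y : V}
    (hy : ∀ j ≤ t, y ≠ p j) (hy1 : G.Adj (p 1) y) {u : V} (hu : G.Adj y u) :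
    ∃ j, 0 < j ∧ j ≤ t ∧ u = p j := by
  rcases hp.neighbor_cases (fun _ => y) one_pos (fun i hi => by omega) hy1.symm
    (fun i hi j hj _ => by omega) (fun _ _ j _ hj => hy j hj) hu with ⟨i, h1, h2, -⟩ | h
  · omega
  · exact h

/-- The chords of the task node to the heights in `B` fulfil the task `T`. -/
structure TaskFits (G : SimpleGraph V) (p : ℕ → V) (t : ℕ) (ν : ℕ → V) (B : ℕ → Finset ℕ)
    (T : ChordTask) : Prop where
  le_card : T.atLeast ≤ (B T.node).card
  card_le : T.exact = true → (B T.node).card ≤ T.atLeast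
  chord : ∀ h ∈ B T.node, G.Adj (ν T.node) (p h) ∧ T.start < h ∧ h ≤ t ∧ (T.node < 4 → T.node + 1 < h)

/-- The vertices `p 0, …, p 3`, followed by those of the list `L`. -/
def pathThen (p : ℕ → V) (L : List V) (i : ℕ) : V := if i < 4 then p i else L.getD (i - 4) (p 0)

theorem IsLongestPath.hasCycleMod_of_refuted (hp : G.IsLongestPath p t) (ht : 3 ≤ t)
    {es : List (ℕ × ℕ)} {Ts : List ChordTask} (L : List V) (h : refuted L.length es Ts = true)
    (hL : L.Nodup) (hoff : ∀ v ∈ L, ∀ j ≤ t, v ≠ p j)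
    (hes : ∀ e ∈ es, (4 ≤ e.2 ∧ e.1 < 4 + L.length ∧ e.2 < 4 + L.length ∧
      ∀ T ∈ Ts, T.node = e.2 → e.1 < 4 → e.1 ≤ T.start))
    (hes' : ∀ e ∈ es, G.Adj (pathThen p L e.1) (pathThen p L e.2))
    (hnd : (Ts.map ChordTask.node).Nodup) (hTs : ∀ T ∈ Ts, T.node < 4 + L.length ∧ T.start < 4)
    (B : ℕ → Finset ℕ) (hB : ∀ T ∈ Ts, G.TaskFits p t (pathThen p L) B T)
    (htot : ReachesTotals B Ts 0) : G.HasCycleMod 2 4 := by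
  have hlow : ∀ i < 4, pathThen p L i = p i := fun i hi => if_pos hi
  have hhigh : ∀ i < L.length, ∃ h : i < L.length, pathThen p L (4 + i) = L[i] := by
    intro i hi
    refine ⟨hi, ?_⟩
    rw [pathThen, if_neg (by omega), Nat.add_sub_cancel_left, List.getD_eq_getElem _ _ hi]
  have hoff' : ∀ i < 4 + L.length, 4 ≤ i → ∀ j ≤ t, pathThen p L i ≠ p j := by
    intro i hi h4 j hj
    obtain ⟨i, rfl⟩ := Nat.exists_eq_add_of_le h4
    obtain ⟨h1, h2⟩ := hhigh i (by omega)
    rw [h2]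
    exact hoff _ (List.getElem_mem h1) j hj
  refine SimpleGraph.hasCycleMod_of_refuted h ht hp.adj hp.inj hlow ?_ hoff'
    (fun e he => ⟨hes e he, hes' e he⟩) hnd hTs
    (fun T hT => ⟨(hB T hT).le_card, (hB T hT).card_le, (hB T hT).chord⟩) htot
  intro i hi j hj hij
  rcases lt_or_ge i 4 with h1 | h1 <;> rcases lt_or_ge j 4 with h2 | h2
  · rw [hlow i h1, hlow j h2] at hij
    exact hp.inj i (by omega) j (by omega) hij
  · rw [hlow i h1] at hij
    exact absurd hij.symm (hoff' j hj h2 i (by omega))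
  · rw [hlow j h2] at hij
    exact absurd hij (hoff' i hi h1 j (by omega))
  · obtain ⟨i, rfl⟩ := Nat.exists_eq_add_of_le h1
    obtain ⟨j, rfl⟩ := Nat.exists_eq_add_of_le h2
    obtain ⟨h3, h4⟩ := hhigh i (by omega)
    obtain ⟨h5, h6⟩ := hhigh j (by omega)
    rw [h4, h6] at hij
    rw [(List.Nodup.getElem_inj_iff hL).1 hij]

end SimpleGraph

/-! ### Vertices forced to have two chords -/

namespace SimpleGraph

variable {V : Type*} [Fintype V] {G : SimpleGraph V} {p : ℕ → V} {t : ℕ}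

/-- The density condition for a single vertex: its degree exceeds `5/2`. -/
theorem IsCritical.lt_card_add (hG : G.IsCritical) {v : V} (hv : ∃ u, u ≠ v) (X : Finset V) {s : ℕ}
    (h : ∀ u, G.Adj v u → u ∈ X ∨ ∃ j, s < j ∧ j ≤ t ∧ u = p j) :
    5 < 2 * (X.card + (G.heightsAfter p t v s).card) := by
  classical
  have key := hG.lt_sum {v} (fun _ => X ∪ (G.heightsAfter p t v s).image p)
    (Finset.singleton_nonempty v) (by simpa using hv) (by
      intro w hw u hu
      rw [Finset.mem_singleton] at hw
      subst hw
      rcases h u hu with h | ⟨j, h1, h2, rfl⟩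
      · exact .inl (Finset.mem_union_left _ h)
      · exact .inl (Finset.mem_union_right _ (Finset.mem_image_of_mem _
          (mem_heightsAfter.2 ⟨h1, h2, hu⟩))))
  rw [Finset.card_singleton, Finset.sum_singleton] at key
  have h1 := Finset.card_union_le X ((G.heightsAfter p t v s).image p)
  have h2 := Finset.card_image_le (s := G.heightsAfter p t v s) (f := p)
  omega

/-- The vertex has degree at least 3, and at most one of its neighbours is at the height `s + 1`. -/
theorem IsCritical.two_le_card_of_forall (hG : G.IsCritical) {v : V} (hv : ∃ u, u ≠ v) {s : ℕ}
    (h : ∀ u, G.Adj v u → ∃ j, s < j ∧ j ≤ t ∧ u = p j) :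
    2 ≤ (G.heightsAfter p t v (s + 1)).card := by
  have h1 := hG.lt_card_add hv ∅ fun u hu => .inr (h u hu)
  have h2 := card_heightsAfter_le (G := G) (p := p) (t := t) v s
  rw [Finset.card_empty] at h1
  omega

theorem IsLongestPath.two_le_card_zero (hp : G.IsLongestPath p t) (hG : G.IsCritical)
    (ht : 0 < t) : 2 ≤ (G.heightsAfter p t (p 0) 1).card :=
  hG.two_le_card_of_forall ⟨p 1, (hp.adj 0 ht).ne'⟩ fun _ hu => hp.exists_eq_of_adj_zero ht hu

theorem IsLongestPath.three_le (hp : G.IsLongestPath p t) (hG : G.IsCritical)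
    (ht : 0 < t) : 3 ≤ t := by
  have h1 := hp.two_le_card_zero hG ht
  have h2 : (G.heightsAfter p t (p 0) 1).card ≤ (Finset.Ioc 1 t).card :=
    Finset.card_le_card fun j hj => by
      rw [mem_heightsAfter] at hj
      rw [Finset.mem_Ioc]
      omega
  rw [Nat.card_Ioc] at h2
  omega

theorem IsLongestPath.two_le_card_leaf (hp : G.IsLongestPath p t) (hG : G.IsCritical) {y : V}
    (hy : ∀ j ≤ t, y ≠ p j) (hy1 : G.Adj (p 1) y) : 2 ≤ (G.heightsAfter p t y 1).card :=
  hG.two_le_card_of_forall ⟨p 0, (hy 0 (Nat.zero_le t)).symm⟩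
    fun _ hu => hp.exists_eq_of_adj_leaf hy hy1 hu

/-- If `z` has a neighbour `w` off the path, then `w, z, p 2, …, p t` is again a longest path, so
besides `z` the neighbours of `w` are on `p` from height 2 on. Otherwise all neighbours of `z` are
on `p`. -/
theorem IsLongestPath.branch_two (hp : G.IsLongestPath p t) (hG : G.IsCritical) {z : V}
    (hz : ∀ j ≤ t, z ≠ p j) (hz2 : G.Adj (p 2) z) (hlow : ∀ j < 2, ¬ G.Adj (p j) z) :
    2 ≤ (G.heightsAfter p t z 2).card ∨
      ∃ w, (∀ j ≤ t, w ≠ p j) ∧ w ≠ z ∧ G.Adj z w ∧ 2 ≤ (G.heightsAfter p t w 1).card := by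
  by_cases hw : ∃ w, (∀ j ≤ t, w ≠ p j) ∧ G.Adj z w
  · obtain ⟨w, hw, hzw⟩ := hw
    refine .inr ⟨w, hw, hzw.ne', hzw, ?_⟩
    have key := hG.lt_card_add (p := p) (t := t) (s := 1) ⟨z, hzw.ne⟩ {z} fun u hu => by
      rcases hp.neighbor_cases (fun i => if i = 0 then w else z) (m := 2) two_pos
        (fun i hi => by obtain rfl : i = 0 := by omega
                        exact hzw.symm) hz2.symm
        (fun i hi j hj hij => by
          have := hzw.ne
          have := hzw.ne'
          interval_cases i <;> interval_cases j <;> simp_all)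
        (fun i hi j _ hj => by
          interval_cases i
          · exact hw j hj
          · exact hz j hj) hu with ⟨i, h1, h2, h3⟩ | h
      · obtain rfl : i = 1 := by omega
        exact .inl (by simpa using h3)
      · exact .inr h
    rw [Finset.card_singleton] at key
    omega
  · push Not at hw
    refine .inl (hG.two_le_card_of_forall ⟨p 0, (hz 0 (Nat.zero_le t)).symm⟩ fun u hu => ?_)
    by_contra hno
    push Not at hno
    refine hw u (fun j hj he => ?_) hu
    have : ¬ 1 < j := fun h => hno j h hj he
    exact hlow j (by omega) (he ▸ hu.symm)

/-- The branch is followed for up to three vertices `z, w, w'`. When it has three, `w', w, z, p 3,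
…, p t` is a longest path, so it ends there and `w'` has no further neighbours off the path. -/
theorem IsLongestPath.branch_three (hp : G.IsLongestPath p t) (hG : G.IsCritical) {z : V}
    (hz : ∀ j ≤ t, z ≠ p j) (hz3 : G.Adj (p 3) z)
    (hlow : ∀ v, (∀ j ≤ t, v ≠ p j) → ∀ j < 3, ¬ G.Adj (p j) v) :
    2 ≤ (G.heightsAfter p t z 3).card ∨
      (∃ w, (∀ j ≤ t, w ≠ p j) ∧ w ≠ z ∧ G.Adj z w ∧ 2 ≤ (G.heightsAfter p t w 2).card) ∨
      ∃ w w', (∀ j ≤ t, w ≠ p j) ∧ (∀ j ≤ t, w' ≠ p j) ∧ w ≠ z ∧ w' ≠ z ∧ w' ≠ w ∧ G.Adj z w ∧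
        G.Adj w w' ∧ 2 ≤ (G.heightsAfter p t w' 2).card := by
  classical
  have hon : ∀ v, (∀ j ≤ t, v ≠ p j) → ∀ u, G.Adj v u → ¬ (∀ j ≤ t, u ≠ p j) →
      ∃ j, 2 < j ∧ j ≤ t ∧ u = p j := by
    intro v hv u hu hno
    push Not at hno
    obtain ⟨j, hj, rfl⟩ := hno
    refine ⟨j, ?_, hj, rfl⟩
    by_contra h
    exact hlow v hv j (by omega) hu.symm
  by_cases hw : ∃ w, (∀ j ≤ t, w ≠ p j) ∧ G.Adj z w
  · obtain ⟨w, hw, hzw⟩ := hw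
    refine .inr ?_
    by_cases hw' : ∃ w', (∀ j ≤ t, w' ≠ p j) ∧ w' ≠ z ∧ G.Adj w w'
    · obtain ⟨w', hw', hne, hww'⟩ := hw'
      refine .inr ?_
      have hend : ∀ a b, (∀ j ≤ t, a ≠ p j) → (∀ j ≤ t, b ≠ p j) → a ≠ z → G.Adj z b →
          G.Adj b a → ∀ u, G.Adj a u → u = b ∨ u = z ∨ ∃ j, 2 < j ∧ j ≤ t ∧ u = p j := by
        intro a b ha hb haz hzb hba u hu
        rcases hp.neighbor_cases (fun i => if i = 0 then a else if i = 1 then b else z) (m := 3)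
          three_pos
          (fun i hi => by
            obtain rfl | rfl : i = 0 ∨ i = 1 := by omega
            · exact hba.symm
            · exact hzb.symm) hz3.symm
          (fun i hi j hj hij => by
            have := hzb.ne
            have := hzb.ne'
            have := hba.ne
            have := hba.ne'
            have := haz.symm
            interval_cases i <;> interval_cases j <;> simp_all)
          (fun i hi j _ hj => by
            interval_cases i
            · exact ha j hj
            · exact hb j hj
            · exact hz j hj) hu with ⟨i, h1, h2, h3⟩ | h
        · obtain rfl | rfl : i = 1 ∨ i = 2 := by omega
          · exact .inl (by simpa using h3)
          · exact .inr (.inl (by simpa using h3))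
        · exact .inr (.inr h)
      -- If `z, w, w'` form a triangle, either of `w, w'` can be the last vertex of the branch. The
      -- density condition for `{w, w'}`, which meets three edges of the triangle, leaves at least
      -- three chords, so one of the two has two of them.
      by_cases hzw' : G.Adj z w'
      · have key := hG.lt_sum {w, w'} (fun v => if v = w
          then insert z ((G.heightsAfter p t w 2).image p)
          else insert w (insert z ((G.heightsAfter p t w' 2).image p))) (by simp)
          ⟨z, by simp [hzw.ne, hzw'.ne]⟩ (by
            intro v hv u hu
            rw [Finset.mem_insert, Finset.mem_singleton] at hv
            rcases hv with rfl | rfl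
            · rw [if_pos rfl]
              rcases hend v w' hw hw' hzw.ne' hzw' hww'.symm u hu with rfl | rfl | ⟨j, h1, h2, rfl⟩
              · exact .inr ⟨by simp, by rw [if_neg hww'.ne']; simp⟩
              · exact .inl (by simp)
              · exact .inl (Finset.mem_insert_of_mem (Finset.mem_image_of_mem _
                  (mem_heightsAfter.2 ⟨h1, h2, hu⟩)))
            · rw [if_neg hww'.ne']
              rcases hend v w hw' hw hne hzw hww' u hu with rfl | rfl | ⟨j, h1, h2, rfl⟩
              · exact .inl (by simp)
              · exact .inl (by simp)
              · exact .inl (Finset.mem_insert_of_mem (Finset.mem_insert_of_mem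
                  (Finset.mem_image_of_mem _ (mem_heightsAfter.2 ⟨h1, h2, hu⟩)))))
        rw [Finset.card_pair hww'.ne, Finset.sum_pair hww'.ne, if_pos rfl, if_neg hww'.ne'] at key
        have h1 := Finset.card_insert_le z ((G.heightsAfter p t w 2).image p)
        have h2 := Finset.card_insert_le w (insert z ((G.heightsAfter p t w' 2).image p))
        have h3 := Finset.card_insert_le z ((G.heightsAfter p t w' 2).image p)
        have h4 := Finset.card_image_le (s := G.heightsAfter p t w 2) (f := p)
        have h5 := Finset.card_image_le (s := G.heightsAfter p t w' 2) (f := p)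
        rcases (show 2 ≤ (G.heightsAfter p t w 2).card ∨ 2 ≤ (G.heightsAfter p t w' 2).card by
          omega) with h | h
        · exact ⟨w', w, hw', hw, hne, hzw.ne', hww'.ne, hzw', hww'.symm, h⟩
        · exact ⟨w, w', hw, hw', hzw.ne', hne, hww'.ne', hzw, hww', h⟩
      · refine ⟨w, w', hw, hw', hzw.ne', hne, hww'.ne', hzw, hww', ?_⟩
        have key := hG.lt_card_add (p := p) (t := t) (s := 2) ⟨z, hne.symm⟩ {w} fun u hu => by
          rcases hend w' w hw' hw hne hzw hww' u hu with rfl | rfl | h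
          · exact .inl (by simp)
          · exact absurd hu.symm hzw'
          · exact .inr h
        rw [Finset.card_singleton] at key
        omega
    · push Not at hw'
      refine .inl ⟨w, hw, hzw.ne', hzw, ?_⟩
      have key := hG.lt_card_add (p := p) (t := t) (s := 2) ⟨z, hzw.ne⟩ {z} fun u hu => by
        by_cases huz : u = z
        · exact .inl (by simpa using huz)
        · exact .inr (hon w hw u hu fun h => hw' u h huz hu)
      rw [Finset.card_singleton] at key
      omega
  · push Not at hw
    exact .inl (hG.two_le_card_of_forall ⟨p 0, (hz 0 (Nat.zero_le t)).symm⟩ fun u hu =>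
      hon z hz u hu fun h => hw u h hu)

end SimpleGraph

/-! ### The computations applied to longest paths -/

namespace SimpleGraph

variable {V : Type*} {G : SimpleGraph V} {p : ℕ → V} {t : ℕ}

/-- The start of a task may lie below the true bound `i + 1`: the search starts at one of the nodes
`0, …, 3`, so node 3 gets the start 3 although its chords go above height 4. This only enlarges the
search. -/
theorem taskFits_path {L : List V} {B : ℕ → Finset ℕ} {i s n tot : ℕ} (hi : i < 4)
    (hs : s ≤ i + 1) (hB : B i = G.heightsAfter p t (p i) (i + 1))
    (hn : n ≤ (G.heightsAfter p t (p i) (i + 1)).card) :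
    G.TaskFits p t (pathThen p L) B ⟨i, s, n, false, tot⟩ := by
  refine ⟨by rwa [hB], by simp, fun h hh => ?_⟩
  simp only at hh ⊢
  rw [hB, mem_heightsAfter] at hh
  rw [pathThen, if_pos hi]
  exact ⟨hh.2.2, by omega, hh.2.1, fun _ => hh.1⟩

theorem taskFits_off {L : List V} {B : ℕ → Finset ℕ} {i s n tot : ℕ} {e : Bool} {v : V}
    (hi : 4 ≤ i) (hv : pathThen p L i = v) (hB : B i ⊆ G.heightsAfter p t v s)
    (hn : n ≤ (B i).card) (he : e = true → (B i).card ≤ n) :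
    G.TaskFits p t (pathThen p L) B ⟨i, s, n, e, tot⟩ := by
  refine ⟨hn, he, fun h hh => ?_⟩
  have hh := hB hh
  rw [mem_heightsAfter] at hh
  simp only
  rw [hv]
  exact ⟨hh.2.2, hh.1, hh.2.1, fun h => by omega⟩

theorem IsLongestPath.hasCycleMod_of_three_leaves (hp : G.IsLongestPath p t) (ht : 3 ≤ t)
    {y y' : V} (hy : ∀ j ≤ t, y ≠ p j) (hy' : ∀ j ≤ t, y' ≠ p j) (hne : y ≠ y')
    (hy1 : G.Adj (p 1) y) (hy1' : G.Adj (p 1) y')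
    (h0 : 2 ≤ (G.heightsAfter p t (p 0) 1).card) (h1 : 2 ≤ (G.heightsAfter p t y 1).card)
    (h2 : 2 ≤ (G.heightsAfter p t y' 1).card) : G.HasCycleMod 2 4 := by
  -- Two chords are kept at each vertex, because the tasks of this search are exact.
  obtain ⟨A, hA, hA2⟩ := Finset.exists_subset_card_eq h0
  obtain ⟨C, hC, hC2⟩ := Finset.exists_subset_card_eq h1
  obtain ⟨E, hE, hE2⟩ := Finset.exists_subset_card_eq h2
  refine hp.hasCycleMod_of_refuted ht [y, y'] refuted_three_leaves (by simpa using hne)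
    (by simpa using ⟨hy, hy'⟩) (by simp) (by simp [hy1, hy1', pathThen]) (by simp) (by simp)
    (fun i => [A, ∅, ∅, ∅, C, E].getD i ∅) ?_ (by simp [ReachesTotals])
  simp only [List.forall_mem_cons, List.not_mem_nil, false_imp_iff, implies_true, and_true]
  refine ⟨⟨hA2.ge, fun _ => hA2.le, fun h hh => ?_⟩,
    taskFits_off (v := y) (by omega) rfl hC hC2.ge fun _ => hC2.le,
    taskFits_off (v := y') (by omega) rfl hE hE2.ge fun _ => hE2.le⟩
  have := mem_heightsAfter.1 (hA hh)
  exact ⟨this.2.2, this.1, this.2.1, fun _ => this.1⟩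

theorem IsLongestPath.hasCycleMod_of_twin (hp : G.IsLongestPath p t) (ht : 3 ≤ t) {y : V}
    (hy : ∀ j ≤ t, y ≠ p j) (hy1 : G.Adj (p 1) y)
    (h0 : 2 ≤ (G.heightsAfter p t (p 0) 1).card) (h1 : 2 ≤ (G.heightsAfter p t y 1).card)
    (h2 : 5 ≤ (G.heightsAfter p t (p 0) 1).card + (G.heightsAfter p t y 1).card +
      (G.heightsAfter p t (p 1) 2).card)
    (h3 : 7 ≤ (G.heightsAfter p t (p 0) 1).card + (G.heightsAfter p t y 1).card +
      (G.heightsAfter p t (p 1) 2).card + (G.heightsAfter p t (p 2) 3).card) :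
    G.HasCycleMod 2 4 := by
  refine hp.hasCycleMod_of_refuted ht [y] refuted_twin (by simp)
    (by simpa using hy) (by simp) (by simp [hy1, pathThen]) (by simp) (by simp)
    (fun i => [G.heightsAfter p t (p 0) 1, G.heightsAfter p t (p 1) 2, G.heightsAfter p t (p 2) 3,
      ∅, G.heightsAfter p t y 1].getD i ∅) ?_ ?_
  · simp only [List.forall_mem_cons, List.not_mem_nil, false_imp_iff, implies_true, and_true]
    exact ⟨taskFits_path (by omega) (by omega) rfl h0,
      taskFits_off (v := y) (by omega) rfl subset_rfl h1 (by simp),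
      taskFits_path (by omega) (by omega) rfl (by omega),
      taskFits_path (by omega) (by omega) rfl (by omega)⟩
  · simp [ReachesTotals]
    omega

theorem IsLongestPath.hasCycleMod_of_twin_branch (hp : G.IsLongestPath p t) (ht : 3 ≤ t) {y z : V}
    (hy : ∀ j ≤ t, y ≠ p j) (hy1 : G.Adj (p 1) y) (hyp : ∀ u, G.Adj y u → ∃ j ≤ t, u = p j)
    (h0 : 2 ≤ (G.heightsAfter p t (p 0) 1).card) (h1 : 2 ≤ (G.heightsAfter p t y 1).card)
    (h2 : 5 ≤ (G.heightsAfter p t (p 0) 1).card + (G.heightsAfter p t y 1).card +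
      (G.heightsAfter p t (p 1) 2).card)
    (hz : ∀ j ≤ t, z ≠ p j) (hz2 : G.Adj (p 2) z) (hzy : z ≠ y)
    (h : 2 ≤ (G.heightsAfter p t z 2).card ∨
      ∃ w, (∀ j ≤ t, w ≠ p j) ∧ w ≠ z ∧ G.Adj z w ∧ 2 ≤ (G.heightsAfter p t w 1).card) :
    G.HasCycleMod 2 4 := by
  rcases h with h | ⟨w, hw, hwz, hzw, h⟩
  · obtain ⟨C, hC, hC2⟩ := Finset.exists_subset_card_eq h
    refine hp.hasCycleMod_of_refuted ht [z, y] refuted_twin_branch_one (by simpa using hzy)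
      (by simpa using ⟨hz, hy⟩) (by simp) (by simp [hy1, hz2, pathThen]) (by simp) (by simp)
      (fun i => [G.heightsAfter p t (p 0) 1, G.heightsAfter p t (p 1) 2,
        ∅, ∅, C, G.heightsAfter p t y 1].getD i ∅) ?_ ?_
    · simp only [List.forall_mem_cons, List.not_mem_nil, false_imp_iff, implies_true, and_true]
      exact ⟨taskFits_off (v := z) (by omega) rfl hC hC2.ge fun _ => hC2.le,
        taskFits_path (by omega) (by omega) rfl h0,
        taskFits_off (v := y) (by omega) rfl subset_rfl h1 (by simp),
        taskFits_path (by omega) (by omega) rfl (by omega)⟩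
    · simp [ReachesTotals]
      omega
  · have hwy : w ≠ y := by
      rintro rfl
      obtain ⟨j, hj, he⟩ := hyp z hzw.symm
      exact hz j hj he
    obtain ⟨C, hC, hC2⟩ := Finset.exists_subset_card_eq h
    refine hp.hasCycleMod_of_refuted ht [z, w, y] refuted_twin_branch_two
      (by simp [hzy, hwz.symm, hwy])
      (by simpa using ⟨hz, hw, hy⟩) (by simp) (by simp [hy1, hz2, hzw, pathThen]) (by simp) (by simp)
      (fun i => [G.heightsAfter p t (p 0) 1, G.heightsAfter p t (p 1) 2,
        ∅, ∅, ∅, C, G.heightsAfter p t y 1].getD i ∅) ?_ ?_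
    · simp only [List.forall_mem_cons, List.not_mem_nil, false_imp_iff, implies_true, and_true]
      exact ⟨taskFits_off (v := w) (by omega) rfl hC hC2.ge fun _ => hC2.le,
        taskFits_path (by omega) (by omega) rfl h0,
        taskFits_off (v := y) (by omega) rfl subset_rfl h1 (by simp),
        taskFits_path (by omega) (by omega) rfl (by omega)⟩
    · simp [ReachesTotals]
      omega

theorem IsLongestPath.hasCycleMod_of_short_chain_branch (hp : G.IsLongestPath p t) (ht : 3 ≤ t)
    {z : V} (h0 : 2 ≤ (G.heightsAfter p t (p 0) 1).card)
    (h1 : 4 ≤ (G.heightsAfter p t (p 0) 1).card + (G.heightsAfter p t (p 1) 2).card)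
    (hz : ∀ j ≤ t, z ≠ p j) (hz2 : G.Adj (p 2) z)
    (h : 2 ≤ (G.heightsAfter p t z 2).card ∨
      ∃ w, (∀ j ≤ t, w ≠ p j) ∧ w ≠ z ∧ G.Adj z w ∧ 2 ≤ (G.heightsAfter p t w 1).card) :
    G.HasCycleMod 2 4 := by
  rcases h with h | ⟨w, hw, hwz, hzw, h⟩
  · obtain ⟨C, hC, hC2⟩ := Finset.exists_subset_card_eq h
    refine hp.hasCycleMod_of_refuted ht [z] refuted_short_chain_branch_one (by simp)
      (by simpa using hz) (by simp) (by simp [hz2, pathThen]) (by simp) (by simp)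
      (fun i => [G.heightsAfter p t (p 0) 1, G.heightsAfter p t (p 1) 2, ∅, ∅, C].getD i ∅) ?_ ?_
    · simp only [List.forall_mem_cons, List.not_mem_nil, false_imp_iff, implies_true, and_true]
      exact ⟨taskFits_off (v := z) (by omega) rfl hC hC2.ge fun _ => hC2.le,
        taskFits_path (by omega) (by omega) rfl h0,
        taskFits_path (by omega) (by omega) rfl (by omega)⟩
    · simp [ReachesTotals]
      omega
  · obtain ⟨C, hC, hC2⟩ := Finset.exists_subset_card_eq h
    refine hp.hasCycleMod_of_refuted ht [z, w] refuted_short_chain_branch_two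
      (by simp [hwz.symm])
      (by simpa using ⟨hz, hw⟩) (by simp) (by simp [hz2, hzw, pathThen]) (by simp) (by simp)
      (fun i => [G.heightsAfter p t (p 0) 1, G.heightsAfter p t (p 1) 2, ∅, ∅, ∅, C].getD i ∅) ?_ ?_
    · simp only [List.forall_mem_cons, List.not_mem_nil, false_imp_iff, implies_true, and_true]
      exact ⟨taskFits_off (v := w) (by omega) rfl hC hC2.ge fun _ => hC2.le,
        taskFits_path (by omega) (by omega) rfl h0,
        taskFits_path (by omega) (by omega) rfl (by omega)⟩
    · simp [ReachesTotals]
      omega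

theorem IsLongestPath.hasCycleMod_of_chain_branch (hp : G.IsLongestPath p t) (ht : 3 ≤ t)
    {z : V} (h0 : 2 ≤ (G.heightsAfter p t (p 0) 1).card)
    (h1 : 4 ≤ (G.heightsAfter p t (p 0) 1).card + (G.heightsAfter p t (p 1) 2).card)
    (h2 : 5 ≤ (G.heightsAfter p t (p 0) 1).card + (G.heightsAfter p t (p 1) 2).card +
      (G.heightsAfter p t (p 2) 3).card)
    (hz : ∀ j ≤ t, z ≠ p j) (hz3 : G.Adj (p 3) z)
    (h : 2 ≤ (G.heightsAfter p t z 3).card ∨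
      (∃ w, (∀ j ≤ t, w ≠ p j) ∧ w ≠ z ∧ G.Adj z w ∧ 2 ≤ (G.heightsAfter p t w 2).card) ∨
      ∃ w w', (∀ j ≤ t, w ≠ p j) ∧ (∀ j ≤ t, w' ≠ p j) ∧ w ≠ z ∧ w' ≠ z ∧ w' ≠ w ∧ G.Adj z w ∧
        G.Adj w w' ∧ 2 ≤ (G.heightsAfter p t w' 2).card) :
    G.HasCycleMod 2 4 := by
  rcases h with h | ⟨w, hw, hwz, hzw, h⟩ | ⟨w, w', hw, hw', hwz, hwz', hne, hzw, hww', h⟩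
  · obtain ⟨C, hC, hC2⟩ := Finset.exists_subset_card_eq h
    refine hp.hasCycleMod_of_refuted ht [z] refuted_chain_branch_one (by simp)
      (by simpa using hz) (by simp) (by simp [hz3, pathThen]) (by simp) (by simp)
      (fun i => [G.heightsAfter p t (p 0) 1, G.heightsAfter p t (p 1) 2,
        G.heightsAfter p t (p 2) 3, ∅, C].getD i ∅) ?_ ?_
    · simp only [List.forall_mem_cons, List.not_mem_nil, false_imp_iff, implies_true, and_true]
      exact ⟨taskFits_off (v := z) (by omega) rfl hC hC2.ge fun _ => hC2.le,
        taskFits_path (by omega) (by omega) rfl h0,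
        taskFits_path (by omega) (by omega) rfl (by omega),
        taskFits_path (by omega) (by omega) rfl (by omega)⟩
    · simp [ReachesTotals]
      omega
  · obtain ⟨C, hC, hC2⟩ := Finset.exists_subset_card_eq h
    refine hp.hasCycleMod_of_refuted ht [z, w] refuted_chain_branch_two
      (by simp [hwz.symm])
      (by simpa using ⟨hz, hw⟩) (by simp) (by simp [hz3, hzw, pathThen]) (by simp) (by simp)
      (fun i => [G.heightsAfter p t (p 0) 1, G.heightsAfter p t (p 1) 2,
        G.heightsAfter p t (p 2) 3, ∅, ∅, C].getD i ∅) ?_ ?_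
    · simp only [List.forall_mem_cons, List.not_mem_nil, false_imp_iff, implies_true, and_true]
      exact ⟨taskFits_off (v := w) (by omega) rfl hC hC2.ge fun _ => hC2.le,
        taskFits_path (by omega) (by omega) rfl h0,
        taskFits_path (by omega) (by omega) rfl (by omega),
        taskFits_path (by omega) (by omega) rfl (by omega)⟩
    · simp [ReachesTotals]
      omega
  · obtain ⟨C, hC, hC2⟩ := Finset.exists_subset_card_eq h
    refine hp.hasCycleMod_of_refuted ht [z, w, w'] refuted_chain_branch_three
      (by simp [hwz.symm, hwz'.symm, hne.symm])
      (by simpa using ⟨hz, hw, hw'⟩) (by simp) (by simp [hz3, hzw, hww', pathThen]) (by simp) (by simp)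
      (fun i => [G.heightsAfter p t (p 0) 1, G.heightsAfter p t (p 1) 2,
        G.heightsAfter p t (p 2) 3, ∅, ∅, ∅, C].getD i ∅) ?_ ?_
    · simp only [List.forall_mem_cons, List.not_mem_nil, false_imp_iff, implies_true, and_true]
      exact ⟨taskFits_off (v := w') (by omega) rfl hC hC2.ge fun _ => hC2.le,
        taskFits_path (by omega) (by omega) rfl h0,
        taskFits_path (by omega) (by omega) rfl (by omega),
        taskFits_path (by omega) (by omega) rfl (by omega)⟩
    · simp [ReachesTotals]
      omega

theorem IsLongestPath.hasCycleMod_of_chain (hp : G.IsLongestPath p t) (ht : 3 ≤ t)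
    (h0 : 2 ≤ (G.heightsAfter p t (p 0) 1).card)
    (h1 : 4 ≤ (G.heightsAfter p t (p 0) 1).card + (G.heightsAfter p t (p 1) 2).card)
    (h2 : 5 ≤ (G.heightsAfter p t (p 0) 1).card + (G.heightsAfter p t (p 1) 2).card +
      (G.heightsAfter p t (p 2) 3).card)
    (h3 : 7 ≤ (G.heightsAfter p t (p 0) 1).card + (G.heightsAfter p t (p 1) 2).card +
      (G.heightsAfter p t (p 2) 3).card + (G.heightsAfter p t (p 3) 4).card) :
    G.HasCycleMod 2 4 := by
  refine hp.hasCycleMod_of_refuted ht [] refuted_chain (by simp)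
    (by simp) (by simp) (by simp) (by simp) (by simp)
    (fun i => [G.heightsAfter p t (p 0) 1, G.heightsAfter p t (p 1) 2,
      G.heightsAfter p t (p 2) 3, G.heightsAfter p t (p 3) 4].getD i ∅) ?_ ?_
  · simp only [List.forall_mem_cons, List.not_mem_nil, false_imp_iff, implies_true, and_true]
    exact ⟨taskFits_path (by omega) (by omega) rfl h0,
      taskFits_path (by omega) (by omega) rfl (by omega),
      taskFits_path (by omega) (by omega) rfl (by omega),
      taskFits_path (by omega) (by omega) rfl (by omega)⟩
  · simp [ReachesTotals]
    omega

end SimpleGraph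

/-! ### No longest path in a critical graph -/

namespace SimpleGraph

section Critical

variable {V : Type*} [Fintype V] {G : SimpleGraph V} {p : ℕ → V} {t : ℕ}

theorem IsLongestPath.lt_sum_range (hp : G.IsLongestPath p t) (hG : G.IsCritical) {k : ℕ}
    (hk : 0 < k) (hkt : k ≤ t)
    (hon : ∀ i < k, ∀ u, G.Adj (p i) u → ∃ j ≤ t, u = p j) :
    3 * k < 2 * ∑ i ∈ Finset.range k, (G.heightsAfter p t (p i) (i + 1)).card := by
  have key := hG.lt_sum_heightsAfter (p := p) (t := t) (Finset.range k) p id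
    (Finset.nonempty_range_iff.2 hk.ne')
    (fun i hi j hj hij => by
      simp only [Finset.coe_range, Set.mem_Iio] at hi hj
      exact hp.inj i (by omega) j (by omega) hij)
    ⟨p k, fun i hi he => by
      rw [Finset.mem_range] at hi
      have := hp.inj i (by omega) k hkt he
      omega⟩
    (fun i hi u hu => by
      rw [Finset.mem_range] at hi
      obtain ⟨j, hj, rfl⟩ := hon i hi u hu
      rcases lt_trichotomy i j with h | rfl | h
      · exact .inl ⟨j, h, hj, rfl⟩
      · exact absurd rfl hu.ne
      · exact .inr ⟨j, Finset.mem_range.2 (by omega), rfl, i, h, by omega, rfl⟩)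
  simpa using key

/-- The twin `y` of `p 0` is unique by the search with three leaves, and then no other vertex off
the path is adjacent to `p 2`. So the density condition applies to `{p 0, p 1, y}` and `{p 0, p 1, p
2, y}` and supplies the 5 and 7 chords that the twin search refutes. -/
theorem IsCritical.not_isLongestPath_of_leaf (hG : G.IsCritical) (ht : 0 < t) {y : V}
    (hy : ∀ j ≤ t, y ≠ p j) (hy1 : G.Adj (p 1) y) : ¬ G.IsLongestPath p t := by
  intro hp
  have h0 := hp.two_le_card_zero hG ht
  have ht3 := hp.three_le hG ht
  have h1 := hp.two_le_card_leaf hG hy hy1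
  have hyp : ∀ u, G.Adj y u → ∃ j, 0 < j ∧ j ≤ t ∧ u = p j :=
    fun u hu => hp.exists_eq_of_adj_leaf hy hy1 hu
  have hzero : ∀ u, G.Adj (p 0) u → ∃ j, 0 < j ∧ j ≤ t ∧ u = p j :=
    fun u hu => hp.exists_eq_of_adj_zero ht hu
  have hone : ∀ u, G.Adj (p 1) u → u = y ∨ ∃ j ≤ t, u = p j := by
    intro u hu
    by_contra hno
    push Not at hno
    exact hG.not_hasCycleMod (hp.hasCycleMod_of_three_leaves ht3 hy hno.2 hno.1.symm hy1 hu h0 h1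
      (hp.two_le_card_leaf hG hno.2 hu))
  have hpne : ∀ i ≤ t, ∀ j ≤ t, i ≠ j → p i ≠ p j := fun i hi j hj h he => h (hp.inj i hi j hj he)
  -- `y` has the start 0, like `p 0`: its edge to `p 1` counts as its path edge.
  have h2 := hG.lt_sum_heightsAfter (p := p) (t := t) (Finset.range 3)
    (fun i => [p 0, p 1, y].getD i y) (fun i => [0, 1, 0].getD i 0) (by simp)
    (fun i hi j hj hij => by
      simp only [Finset.coe_range, Set.mem_Iio] at hi hj
      have := hpne 0 (by omega) 1 (by omega) (by omega)
      have := hy 0 (by omega)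
      have := hy 1 (by omega)
      interval_cases i <;> interval_cases j <;> simp_all [eq_comm])
    ⟨p 2, fun i hi => by
      rw [Finset.mem_range] at hi
      interval_cases i
      · exact hpne 0 (by omega) 2 (by omega) (by omega)
      · exact hpne 1 (by omega) 2 (by omega) (by omega)
      · exact hy 2 (by omega)⟩
    (fun i hi u hu => by
      rw [Finset.mem_range] at hi
      interval_cases i
      · exact .inl (hzero u hu)
      · rcases hone u hu with rfl | ⟨j, hj, rfl⟩
        · exact .inr ⟨2, by simp, rfl, 1, Nat.one_pos, by omega, rfl⟩
        · rcases (show j = 0 ∨ j = 1 ∨ 1 < j by omega) with rfl | rfl | h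
          · exact .inr ⟨0, by simp, rfl, 1, Nat.one_pos, by omega, rfl⟩
          · exact absurd rfl hu.ne
          · exact .inl ⟨j, h, hj, rfl⟩
      · exact .inl (hyp u hu))
  simp only [Finset.sum_range_succ, Finset.sum_range_zero, Finset.card_range] at h2
  simp at h2
  have h5 : 5 ≤ (G.heightsAfter p t (p 0) 1).card + (G.heightsAfter p t y 1).card +
      (G.heightsAfter p t (p 1) 2).card := by omega
  have htwo : ∀ u, G.Adj (p 2) u → u = y ∨ ∃ j ≤ t, u = p j := by
    intro u hu
    by_contra hno
    push Not at hno
    refine hG.not_hasCycleMod (hp.hasCycleMod_of_twin_branch ht3 hy hy1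
      (fun v hv => (hyp v hv).imp fun j hj => hj.2) h0 h1 h5 hno.2 hu hno.1
      (hp.branch_two hG hno.2 hu fun j hj hadj => ?_))
    interval_cases j
    · obtain ⟨j, -, hj, he⟩ := hzero u hadj
      exact hno.2 j hj he
    · rcases hone u hadj with he | ⟨j, hj, he⟩
      · exact hno.1 he
      · exact hno.2 j hj he
  have h3 := hG.lt_sum_heightsAfter (p := p) (t := t) (Finset.range 4)
    (fun i => [p 0, p 1, p 2, y].getD i y) (fun i => [0, 1, 2, 0].getD i 0) (by simp)
    (fun i hi j hj hij => by
      simp only [Finset.coe_range, Set.mem_Iio] at hi hj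
      have := hpne 0 (by omega) 1 (by omega) (by omega)
      have := hpne 0 (by omega) 2 (by omega) (by omega)
      have := hpne 1 (by omega) 2 (by omega) (by omega)
      have := hy 0 (by omega)
      have := hy 1 (by omega)
      have := hy 2 (by omega)
      interval_cases i <;> interval_cases j <;> simp_all [eq_comm])
    ⟨p 3, fun i hi => by
      rw [Finset.mem_range] at hi
      interval_cases i
      · exact hpne 0 (by omega) 3 (by omega) (by omega)
      · exact hpne 1 (by omega) 3 (by omega) (by omega)
      · exact hpne 2 (by omega) 3 (by omega) (by omega)
      · exact hy 3 (by omega)⟩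
    (fun i hi u hu => by
      rw [Finset.mem_range] at hi
      interval_cases i
      · exact .inl (hzero u hu)
      · rcases hone u hu with rfl | ⟨j, hj, rfl⟩
        · exact .inr ⟨3, by simp, rfl, 1, Nat.one_pos, by omega, rfl⟩
        · rcases (show j = 0 ∨ j = 1 ∨ 1 < j by omega) with rfl | rfl | h
          · exact .inr ⟨0, by simp, rfl, 1, Nat.one_pos, by omega, rfl⟩
          · exact absurd rfl hu.ne
          · exact .inl ⟨j, h, hj, rfl⟩
      · rcases htwo u hu with rfl | ⟨j, hj, rfl⟩
        · exact .inr ⟨3, by simp, rfl, 2, Nat.two_pos, by omega, rfl⟩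
        · rcases (show j = 0 ∨ j = 1 ∨ j = 2 ∨ 2 < j by omega) with rfl | rfl | rfl | h
          · exact .inr ⟨0, by simp, rfl, 2, Nat.two_pos, by omega, rfl⟩
          · exact .inr ⟨1, by simp, rfl, 2, Nat.one_lt_two, by omega, rfl⟩
          · exact absurd rfl hu.ne
          · exact .inl ⟨j, h, hj, rfl⟩
      · exact .inl (hyp u hu))
  simp only [Finset.sum_range_succ, Finset.sum_range_zero, Finset.card_range] at h3
  simp at h3
  exact hG.not_hasCycleMod (hp.hasCycleMod_of_twin ht3 hy hy1 h0 h1 h5 (by omega))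

/-- The vertices `p 1, p 2, p 3` are shown in turn to have all neighbours on the path; each density
bound obtained on the way feeds the search that excludes the next branch. -/
theorem IsCritical.not_isLongestPath (hG : G.IsCritical) (ht : 0 < t) :
    ¬ G.IsLongestPath p t := by
  intro hp
  have h0 := hp.two_le_card_zero hG ht
  have ht3 := hp.three_le hG ht
  have hon0 : ∀ u, G.Adj (p 0) u → ∃ j ≤ t, u = p j :=
    fun u hu => (hp.exists_eq_of_adj_zero ht hu).imp fun j hj => hj.2
  have hon1 : ∀ u, G.Adj (p 1) u → ∃ j ≤ t, u = p j := by
    intro u hu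
    by_contra hno
    push Not at hno
    exact hG.not_isLongestPath_of_leaf ht hno hu hp
  have h1 := hp.lt_sum_range hG (k := 2) (by omega) (by omega) (by
    intro i hi
    interval_cases i
    exacts [hon0, hon1])
  simp only [Finset.sum_range_succ, Finset.sum_range_zero, Nat.reduceAdd] at h1
  have hon2 : ∀ u, G.Adj (p 2) u → ∃ j ≤ t, u = p j := by
    intro u hu
    by_contra hno
    push Not at hno
    refine hG.not_hasCycleMod (hp.hasCycleMod_of_short_chain_branch ht3 h0 (by omega) hno hu
      (hp.branch_two hG hno hu fun j hj hadj => ?_))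
    obtain ⟨i, hi, he⟩ : ∃ i ≤ t, u = p i := by
      interval_cases j
      exacts [hon0 u hadj, hon1 u hadj]
    exact hno i hi he
  have h2 := hp.lt_sum_range hG (k := 3) (by omega) (by omega) (by
    intro i hi
    interval_cases i
    exacts [hon0, hon1, hon2])
  simp only [Finset.sum_range_succ, Finset.sum_range_zero, Nat.reduceAdd] at h2
  have hon3 : ∀ u, G.Adj (p 3) u → ∃ j ≤ t, u = p j := by
    intro u hu
    by_contra hno
    push Not at hno
    refine hG.not_hasCycleMod (hp.hasCycleMod_of_chain_branch ht3 h0 (by omega) (by omega) hno hu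
      (hp.branch_three hG hno hu fun v hv j hj hadj => ?_))
    obtain ⟨i, hi, he⟩ : ∃ i ≤ t, v = p i := by
      interval_cases j
      exacts [hon0 v hadj, hon1 v hadj, hon2 v hadj]
    exact hv i hi he
  -- The set `{p 0, …, p 3}` must leave out a vertex. For `t = 3` there is room for at most `2 + 1 +
  -- 0` chords, but five are known.
  have ht4 : 4 ≤ t := by
    have e0 := card_heightsAfter_le_sub (G := G) (p := p) (t := t) (p 0) 1
    have e1 := card_heightsAfter_le_sub (G := G) (p := p) (t := t) (p 1) 2
    have e2 := card_heightsAfter_le_sub (G := G) (p := p) (t := t) (p 2) 3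
    omega
  have h3 := hp.lt_sum_range hG (k := 4) (by omega) ht4 (by
    intro i hi
    interval_cases i
    exacts [hon0, hon1, hon2, hon3])
  simp only [Finset.sum_range_succ, Finset.sum_range_zero, Nat.reduceAdd] at h3
  exact hG.not_hasCycleMod (hp.hasCycleMod_of_chain ht3 h0 (by omega) (by omega) (by omega))

end Critical

/-! ### Reduction to critical graphs -/

theorem exists_isLongestPath {V : Type*} [Finite V] {G : SimpleGraph V} {u v : V}
    (huv : G.Adj u v) : ∃ (p : ℕ → V) (t : ℕ), 0 < t ∧ G.IsLongestPath p t := by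
  classical
  let P : ℕ → Prop := fun t => ∃ q : ℕ → V, (∀ i < t, G.Adj (q i) (q (i + 1))) ∧
    ∀ i ≤ t, ∀ j ≤ t, q i = q j → i = j
  have hbound : ∀ t, P t → t ≤ Nat.card V := by
    rintro t ⟨q, -, hq⟩
    have := Nat.card_le_card_of_injective (fun i : Fin t => q i) fun i j hij =>
      Fin.ext (hq i i.2.le j j.2.le hij)
    simpa using this
  have hone : P 1 := by
    refine ⟨fun i => if i = 0 then u else v, fun i hi => ?_, fun i hi j hj hij => ?_⟩
    · obtain rfl : i = 0 := by omega
      exact huv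
    · have := huv.ne
      have := huv.ne'
      interval_cases i <;> interval_cases j <;> simp_all
  have hle := Nat.le_findGreatest (hbound 1 hone) hone
  obtain ⟨p, hp1, hp2⟩ := Nat.findGreatest_spec (hbound 1 hone) hone
  refine ⟨p, Nat.findGreatest P (Nat.card V), hle, hp1, hp2, fun q hq1 hq2 => ?_⟩
  have hP : P (Nat.findGreatest P (Nat.card V) + 1) := ⟨q, hq1, hq2⟩
  exact Nat.findGreatest_is_greatest (Nat.lt_succ_self _) (hbound _ hP) hP

theorem HasCycleMod.of_induce {V : Type*} {G : SimpleGraph V} {s : Set V} {ℓ k : ℕ}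
    (h : (G.induce s).HasCycleMod ℓ k) : G.HasCycleMod ℓ k := by
  obtain ⟨v, q, hq, hl⟩ := h
  exact ⟨(Embedding.induce s).toHom v, q.map (Embedding.induce s).toHom,
    hq.map Subtype.val_injective, by rwa [Walk.length_map]⟩

theorem ncard_edgeSet_le_add {V : Type*} [Finite V] (G : SimpleGraph V) (S : Finset V) :
    G.edgeSet.ncard ≤ (G.edgesMeeting S).ncard + (G.induce {v | v ∉ S}).edgeSet.ncard := by
  have hsub : G.edgeSet ⊆ G.edgesMeeting S ∪
      Sym2.map Subtype.val '' (G.induce {v | v ∉ S}).edgeSet := by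
    intro e he
    by_cases hm : ∃ v ∈ S, v ∈ e
    · exact .inl ⟨he, hm⟩
    · refine .inr ?_
      induction e with
      | _ a b =>
        push Not at hm
        exact ⟨s(⟨a, fun ha => hm a ha (by simp)⟩, ⟨b, fun hb => hm b hb (by simp)⟩), he, rfl⟩
  refine (Set.ncard_le_ncard hsub (Set.toFinite _)).trans ((Set.ncard_union_le _ _).trans ?_)
  exact Nat.add_le_add_left (Set.ncard_image_le (Set.toFinite _)) _

/-- By strong induction: a set meeting at most `5/2` edges per vertex can be deleted without
lowering the density below `5/2`, so a counterexample with no smaller ones is critical. -/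
theorem hasCycleMod_of_five_mul_card_le (n : ℕ) :
    ∀ {V : Type} [Fintype V] (G : SimpleGraph V), Fintype.card V = n → 0 < n →
      5 * n ≤ 2 * G.edgeSet.ncard → G.HasCycleMod 2 4 := by
  induction n using Nat.strong_induction_on with
  | _ n ih =>
    intro V _ G hn hpos hcard
    classical
    by_contra hno
    have hG : G.IsCritical := by
      refine ⟨hno, fun S hS hS' => ?_⟩
      by_contra hle
      have hle' := G.ncard_edgeSet_le_add S
      have hc : Fintype.card {v // v ∉ S} = n - S.card := by
        rw [Fintype.card_subtype_compl, hn, Fintype.card_coe]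
      have hSpos := hS.card_pos
      have hSlt : S.card < n := by
        rw [← hn]
        exact Finset.card_lt_univ_of_notMem hS'.choose_spec
      exact hno (HasCycleMod.of_induce (s := {v | v ∉ S}) (ih (n - S.card) (by omega) _ hc
        (by omega) (by omega)))
    obtain ⟨e, he⟩ : G.edgeSet.Nonempty := by
      rw [Set.nonempty_iff_ne_empty]
      intro h
      rw [h, Set.ncard_empty] at hcard
      omega
    induction e with
    | _ u v =>
      obtain ⟨p, t, ht, hp⟩ := exists_isLongestPath he
      exact hG.not_isLongestPath ht hp

end SimpleGraph

/-! ### The extremal example -/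

namespace SimpleGraph

/-- Copies of `K₅` with a common vertex `0`. -/
def windmill (n : ℕ) : SimpleGraph (Fin n) where
  Adj i j := i ≠ j ∧ ((i : ℕ) = 0 ∨ (j : ℕ) = 0 ∨ ((i : ℕ) - 1) / 4 = ((j : ℕ) - 1) / 4)
  symm := ⟨fun _ _ h => ⟨h.1.symm, by tauto⟩⟩
  loopless := ⟨fun _ h => h.1 rfl⟩

/-- Away from the vertex `0` the cycle cannot change its copy of `K₅`, so its inner vertices lie
among the four other vertices of one copy. -/
theorem length_le_five_of_isCycle_windmill {n : ℕ} {v : Fin n} {q : (windmill n).Walk v v}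
    (hq : q.IsCycle) (h0 : ∀ i, 1 ≤ i → i < q.length → (q.getVert i : ℕ) ≠ 0) : q.length ≤ 5 := by
  have hblock : ∀ i, 1 ≤ i → i < q.length →
      ((q.getVert i : ℕ) - 1) / 4 = ((q.getVert 1 : ℕ) - 1) / 4 := by
    intro i hi
    induction i, hi using Nat.le_induction with
    | base => intro _; rfl
    | succ i hi ih =>
      intro hlt
      have hadj := (q.adj_getVert_succ (i := i) (by omega)).2
      have h1 := h0 i hi (by omega)
      have h2 := h0 (i + 1) (by omega) hlt
      rw [← ih (by omega)]
      rcases hadj with h | h | h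
      · exact absurd h h1
      · exact absurd h h2
      · exact h.symm
  have hcard := Finset.card_le_card_of_injOn (s := Finset.Ico 1 q.length) (t := Finset.range 4)
    (fun i => ((q.getVert i : ℕ) - 1) % 4)
    (fun i _ => by simpa using Nat.mod_lt _ (by omega)) (fun i hi j hj hij => by
      rw [Finset.mem_coe, Finset.mem_Ico] at hi hj
      have h1 := hblock i hi.1 hi.2
      have h2 := hblock j hj.1 hj.2
      have h3 := h0 i hi.1 hi.2
      have h4 := h0 j hj.1 hj.2
      simp only at hij
      exact hq.getVert_injOn ⟨hi.1, hi.2.le⟩ ⟨hj.1, hj.2.le⟩ (Fin.ext (by omega)))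
  rw [Nat.card_Ico, Finset.card_range] at hcard
  omega

theorem not_hasCycleMod_windmill (n : ℕ) : ¬ (windmill n).HasCycleMod 2 4 := by
  rintro ⟨v, q, hq, hl⟩
  have h3 := hq.three_le_length
  have hlen : q.length ≤ 5 := by
    by_cases h : ∃ u ∈ q.support, (u : ℕ) = 0
    · obtain ⟨u, hu, hu0⟩ := h
      -- Started at the common vertex, the cycle does not meet it again before its end.
      rw [← q.length_rotate u hu]
      refine length_le_five_of_isCycle_windmill (hq.rotate hu) fun i hi hlt h => ?_
      have hr := hq.rotate hu
      have he : (q.rotate u hu).getVert i = (q.rotate u hu).getVert (q.rotate u hu).length := by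
        rw [Walk.getVert_length]
        exact Fin.ext (by omega)
      have := hr.getVert_injOn ⟨hi, hlt.le⟩ ⟨by omega, le_rfl⟩ he
      omega
    · push Not at h
      exact length_le_five_of_isCycle_windmill hq fun i _ _ => h _ (q.getVert_mem_support i)
  rw [Nat.ModEq] at hl
  omega

/-- The ten pairs `a < b` in each of the `m` copies give distinct edges; `ι q a` is the vertex `a`
of the copy `q`, with `a = 0` the common one. -/
theorem le_ncard_edgeSet_windmill (m : ℕ) : 10 * m ≤ (windmill (4 * m + 1)).edgeSet.ncard := by
  classical
  let ι : ℕ → ℕ → Fin (4 * m + 1) := fun q a => Fin.ofNat _ (if a = 0 then 0 else 4 * q + a)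
  have hι : ∀ q < m, ∀ a < 5, (ι q a : ℕ) = if a = 0 then 0 else 4 * q + a := by
    intro q hq a ha
    refine Nat.mod_eq_of_lt ?_
    split_ifs <;> omega
  let K : Finset (ℕ × ℕ) := (Finset.range 5 ×ˢ Finset.range 5).filter fun a => a.1 < a.2
  have hK : K.card = 10 := by decide
  have hmem : ∀ x ∈ Finset.range m ×ˢ K, x.1 < m ∧ x.2.1 < x.2.2 ∧ x.2.2 < 5 := by
    rintro ⟨q, a, b⟩ hx
    simp only [K, Finset.mem_product, Finset.mem_filter, Finset.mem_range] at hx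
    exact ⟨hx.1, hx.2.2, hx.2.1.2⟩
  have hinj : Set.InjOn (fun x : ℕ × ℕ × ℕ => s(ι x.1 x.2.1, ι x.1 x.2.2))
      ↑(Finset.range m ×ˢ K) := by
    rintro ⟨q, a, b⟩ hx ⟨q', a', b'⟩ hx' he
    obtain ⟨h1, h2, h3⟩ := hmem _ (Finset.mem_coe.1 hx)
    obtain ⟨h4, h5, h6⟩ := hmem _ (Finset.mem_coe.1 hx')
    simp only at h1 h2 h3 h4 h5 h6 he
    have e1 := hι q h1 a (by omega)
    have e2 := hι q h1 b h3
    have e3 := hι q' h4 a' (by omega)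
    have e4 := hι q' h4 b' h6
    rw [if_neg (by omega)] at e2 e4
    rw [Sym2.eq_iff] at he
    rcases he with ⟨f1, f2⟩ | ⟨f1, f2⟩
    · rw [f1] at e1
      rw [f2] at e2
      have : q = q' ∧ a = a' ∧ b = b' := by
        split_ifs at e1 e3 <;> omega
      rw [this.1, this.2.1, this.2.2]
    · rw [f1] at e1
      rw [f2] at e2
      split_ifs at e1 e3 <;> omega
  calc 10 * m = ((Finset.range m ×ˢ K).image
        (fun x : ℕ × ℕ × ℕ => s(ι x.1 x.2.1, ι x.1 x.2.2))).card := by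
        rw [Finset.card_image_of_injOn hinj, Finset.card_product, hK, Finset.card_range, mul_comm]
    _ ≤ _ := by
        rw [← Set.ncard_coe_finset]
        refine Set.ncard_le_ncard (fun e he => ?_) (Set.toFinite _)
        obtain ⟨⟨q, a, b⟩, hx, rfl⟩ := Finset.mem_image.1 (Finset.mem_coe.1 he)
        obtain ⟨h1, h2, h3⟩ := hmem _ hx
        simp only at h1 h2 h3
        have e1 := hι q h1 a (by omega)
        have e2 := hι q h1 b h3
        rw [if_neg (by omega)] at e2
        have hadj : (windmill (4 * m + 1)).Adj (ι q a) (ι q b) := by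
          refine ⟨fun h => ?_, ?_⟩
          · rw [h] at e1
            split_ifs at e1 <;> omega
          · split_ifs at e1 <;> omega
        exact hadj

end SimpleGraph

theorem corollary1p4 : IsBurrErdosConstant 2 4 (5 / 2) := by
  refine ⟨fun n hn G hG => ?_, fun c hc => ?_⟩
  · refine SimpleGraph.hasCycleMod_of_five_mul_card_le n G (Fintype.card_fin n) hn ?_
    have : (5 * n : ℝ) ≤ 2 * G.edgeSet.ncard := by linarith
    exact_mod_cast this
  · by_contra hlt
    push Not at hlt
    -- For `c < 5/2` this choice of `m` amounts to `c * (4m + 1) ≤ 10m`.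
    obtain ⟨m, hm⟩ := exists_nat_ge (c / (10 - 4 * c))
    rw [div_le_iff₀ (by linarith)] at hm
    refine SimpleGraph.not_hasCycleMod_windmill _ (hc (4 * m + 1) (by omega)
      (SimpleGraph.windmill (4 * m + 1)) ?_)
    have : (10 * m : ℝ) ≤ (SimpleGraph.windmill (4 * m + 1)).edgeSet.ncard := by
      exact_mod_cast SimpleGraph.le_ncard_edgeSet_windmill m
    push_cast
    linarith
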